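/- **The calculus $\lambda_{\forall[]}$.** Let $x,y$ range over variables, $i,j$ over weakening variables, $\gamma,\delta$ over context variables, $\tau$ over an arbitrary set of base types, $n\in\mathbb N$. The syntax is $$\begin{array}{ll} \text{types} & S,T ::= \tau \mid S\to T \mid [\vec S]T \mid \forall\gamma.T\\ \text{terms} & M,N ::= x \mid \lambda x{:}T.M \mid MN \mid \mathsf{quo}\langle\Gamma\rangle M \mid \mathsf{unq}_n\langle\vec N\rangle M \mid \Lambda\gamma.M \mid M@\vec S\\ \text{type sequences} & \vec S ::= \cdot \mid \vec S,T \mid \vec S,\gamma\\ \text{term sequences} & \vec M ::= \cdot \mid \vec M,N \mid \vec M,i\\ \text{contexts} & \Gamma ::= \cdot \mid \Gamma,x{:}T \mid \Gamma,i{:}\gamma\\ \text{context stacks} & \Psi ::= \cdot \mid \Psi;\Gamma \end{array}$$ where the names declared in one context are distinct, $\mathsf{quo}\langle\Gamma\rangle M$ binds $\mathrm{dom}(\Gamma)$ in $M$, and types and terms are taken up to $\alpha$-equivalence. The context $\Gamma_l$ of a stack $\Psi;\Gamma_l;\ldots;\Gamma_1$ has level $l$; variables and weakening variables have levels, with $\mathsf{quo}$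 raising the level by $1$ and $\mathsf{unq}_n$ lowering it by $n$ in $M$ (not in $\vec N$), while context variables have none. Typing, in each of the variants $\mathbb A\in\{K,T,K4,S4\}$, is given by the rules: * $\Psi;\Gamma\vdash x:T$ if $x{:}T\in\Gamma$; * $\Psi;\Gamma\vdash\lambda x{:}T.M:T\to S$ if $\Psi;\Gamma,x{:}T\vdash M:S$; * $\Psi;\Gamma\vdash MN:S$ if $\Psi;\Gamma\vdash M:T\to S$ and $\Psi;\Gamma\vdash N:T$; * $\Psi\vdash\mathsf{quo}\langle\Gamma\rangle M:[\mathrm{rg}(\Gamma)]T$ if $\Psi;\Gamma\vdash M:T$; * $\Psi;\Gamma_n;\ldots;\Gamma_1\vdash\mathsf{unq}_n\langle\vec N\rangle M:S$ if $\Psi\vdash M:[\vec T]S$ and $\Psi;\Gamma_n;\ldots;\Gamma_1\vdash\vec N:\vec T$, where $n=1$ for $K$, $n\in\{0,1\}$ for $T$, $n\ge1$ for $K4$, $n\ge0$ for $S4$; for $n=0$ the stack $\Psi$ must be nonempty; * $\Psi\vdash\Lambda\gamma.M:\forall\gamma.T$ if $\Psi\vdash M:T$ and $\gamma$ is not free in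 $\Psi$; * $\Psi\vdash M@\vec S:T[\vec S/\gamma]$ if $\Psi\vdash M:\forall\gamma.T$; * $\Psi\vdash\cdot:\cdot$; $\ \Psi\vdash\vec N,M:\vec S,T$ if $\Psi\vdash\vec N:\vec S$ and $\Psi\vdash M:T$; $\ \Psi;\Gamma\vdash\vec M,i:\vec S,\gamma$ if $\Psi;\Gamma\vdash\vec M:\vec S$ and $i{:}\gamma\in\Gamma$. There are three meta-operations on terms. * For $l\ge1$, the term substitution $M[\sigma]_l$ is the capture-avoiding simultaneous substitution, for level-$l$ variables and weakening variables of $M$, of terms $N/x$ and of term sequences $\vec N/i$ (which are spliced into the surrounding sequence). * For $l\ge1$, $n\ge0$, the level substitution $M{\uparrow}^n_l$ changes the levels of unquotations (bound names being renamed where necessary to avoid capture): it is homomorphic except that $(\mathsf{quo}\langle\Gamma\rangle M){\uparrow}^n_l=\mathsf{quo}\langle\Gamma\rangle(M{\uparrow}^n_{l+1})$, and $(\mathsf{unq}_k\langle\vec N\rangle M){\uparrow}^n_l$ is $\mathsf{unq}_{k+n-1}\langle\vec N{\uparrow}^n_l\rangle M$ if $l\le k$ and $\mathsf{unq}_k\langle\vec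 N{\uparrow}^n_l\rangle(M{\uparrow}^n_{l-k})$ otherwise. * The context substitution $[\vec S/\gamma]$ on types, sequences and terms is capture-avoiding and homomorphic, splices $\vec S$ for $\gamma$ in type sequences, and on quotations is $(\mathsf{quo}\langle\Gamma\rangle M)[\vec S/\gamma]=\mathsf{quo}\langle\Delta\rangle(M[\vec S/\gamma][\sigma]_1)$. Here $\Delta$ arises from $\Gamma$, in the same order, by replacing each $x{:}T$ by $x{:}T[\vec S/\gamma]$ and each $i{:}\gamma$ by a context $\Delta'_i$ of fresh names with range $\vec S$, and $\sigma$ substitutes $\mathrm{dom}(\Delta'_i)$ for each such $i$. $\beta$-reduction $\to_\beta$ is the congruence closure of $$(\lambda x{:}T.M)N\to M[N/x]_1,\qquad \mathsf{unq}_n\langle\vec N\rangle(\mathsf{quo}\langle\Gamma\rangle M)\to M{\uparrow}^n_1[\vec N/\Gamma]_1,\qquad (\Lambda\gamma.M)@\vec S\to M[\vec S/\gamma],$$ the second one when $\vec N$ and $\Gamma$ match entry by entry (terms against variables, weakening variables against weakening variables). $\eta$-expansion $\to_\eta$ is the relation $M\to_\eta N$ relative to a context stack, closed under the congruence rules, where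 each rule is applied to a subterm under the stack $\Psi$ that belongs to its position: $$\begin{array}{ll} M\to\lambda x{:}T.\,Mx & \text{if }\Psi\vdash M:T\to S,\\ M\to\mathsf{quo}\langle\Gamma\rangle(\mathsf{unq}_1\langle\mathrm{dom}(\Gamma)\rangle M) & \text{if }\Psi\vdash M:[\vec T]S\text{ and }\mathrm{rg}(\Gamma)=\vec T,\\ M\to\Lambda\gamma.(M@\gamma) & \text{if }\Psi\vdash M:\forall\delta.S, \end{array}$$ with $x$ and $\gamma$ fresh. **Theorem (Subject Reduction/Expansion for $\lambda_{\forall[]}$).** In each of the variants $K$, $T$, $K4$, $S4$, for every context stack $\Psi$, all terms $M,N$ and every type $T$: 1. if $\Psi\vdash M:T$ and $M\to_\beta N$, then $\Psi\vdash N:T$; 2. if $\Psi\vdash M:T$ and $M\to_\eta N$ under $\Psi$, then $\Psi\vdash N:T$. -/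

import Mathlib

/-!
Syntax, typing, beta-reduction and eta-expansion of the contextual modal calculus with
polymorphic contexts, in its K, T, K4 and S4 variants.

Terms and types are taken modulo alpha-equivalence by means of de Bruijn indices. There are three
disjoint kinds of names, hence three independent index spaces:

* variables `x`: the index counts the entries `x : T` of the current (level-1) context;
* weakening variables `i`: the index counts the entries `i : γ` of the current (level-1) context;
* context variables `γ`: the index counts the enclosing binders `∀ γ` and `Λ γ`; context variables
  have no level.

Sequences grow to the right. A context is a list whose head is its rightmost entry, and a context
stack `Γ_n; …; Γ_1` is a list whose head is `Γ_1`.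
-/

namespace CtxModal

universe u

mutual
/-- Types over a set `B` of base types: `τ`, `S → T`, `[S⃗] T` and `∀ γ. T`. -/
inductive Ty (B : Type u) : Type u
  | base (τ : B)
  | arr (S T : Ty B)
  | box (Ss : TySeq B) (T : Ty B)
  | all (T : Ty B)
/-- Type sequences: empty, `S⃗, T` and `S⃗, γ`. -/
inductive TySeq (B : Type u) : Type u
  | nil
  | snoc (Ss : TySeq B) (T : Ty B)
  | snocC (Ss : TySeq B) (γ : ℕ)
end

/-- Entries of a context: `x : T` and `i : γ`. -/
inductive Entry (B : Type u) : Type u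
  | ty (T : Ty B)
  | cv (γ : ℕ)

/-- Contexts; the head of the list is the rightmost entry. -/
abbrev Ctx (B : Type u) : Type u := List (Entry B)

/-- Context stacks; the head of the list is the level-1 context. -/
abbrev Stack (B : Type u) : Type u := List (Ctx B)

mutual
/-- Terms: `x`, `λ x : T. M`, `M N`, the quotation of `M` with environment `Γ` (which binds the
domain of `Γ` in `M`), the unquotation of `M` over `n` levels with arguments `N⃗`, `Λ γ. M` and
`M @ S⃗`. -/
inductive Tm (B : Type u) : Type u
  | var (x : ℕ)
  | lam (T : Ty B) (M : Tm B)
  | app (M N : Tm B)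
  | quo (Γ : Ctx B) (M : Tm B)
  | unq (n : ℕ) (M : Tm B) (Ns : TmSeq B)
  | cabs (M : Tm B)
  | capp (M : Tm B) (Ss : TySeq B)
/-- Term sequences: empty, `M⃗, N` and `M⃗, i`. -/
inductive TmSeq (B : Type u) : Type u
  | nil
  | snoc (Ms : TmSeq B) (N : Tm B)
  | snocW (Ms : TmSeq B) (i : ℕ)
end

variable {B : Type u}

/-- Extension of a renaming of de Bruijn indices under one binder. -/
def up (f : ℕ → ℕ) : ℕ → ℕ
  | 0 => 0
  | k + 1 => f k + 1

/-! ### Renaming of context variables -/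

mutual
def Ty.crename : Ty B → (ℕ → ℕ) → Ty B
  | .base τ, _ => .base τ
  | .arr S T, f => .arr (S.crename f) (T.crename f)
  | .box Ss T, f => .box (Ss.crename f) (T.crename f)
  | .all T, f => .all (T.crename (up f))
def TySeq.crename : TySeq B → (ℕ → ℕ) → TySeq B
  | .nil, _ => .nil
  | .snoc Ss T, f => .snoc (Ss.crename f) (T.crename f)
  | .snocC Ss γ, f => .snocC (Ss.crename f) (f γ)
end

def Entry.crename : Entry B → (ℕ → ℕ) → Entry B
  | .ty T, f => .ty (T.crename f)
  | .cv γ, f => .cv (f γ)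

def Ctx.crename (Γ : Ctx B) (f : ℕ → ℕ) : Ctx B := Γ.map (fun e => e.crename f)

def Stack.crename (Ψ : Stack B) (f : ℕ → ℕ) : Stack B := Ψ.map (fun Γ => Ctx.crename Γ f)

mutual
def Tm.crename : Tm B → (ℕ → ℕ) → Tm B
  | .var x, _ => .var x
  | .lam T M, f => .lam (T.crename f) (M.crename f)
  | .app M N, f => .app (M.crename f) (N.crename f)
  | .quo Γ M, f => .quo (Ctx.crename Γ f) (M.crename f)
  | .unq n M Ns, f => .unq n (M.crename f) (Ns.crename f)
  | .cabs M, f => .cabs (M.crename (up f))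
  | .capp M Ss, f => .capp (M.crename f) (Ss.crename f)
def TmSeq.crename : TmSeq B → (ℕ → ℕ) → TmSeq B
  | .nil, _ => .nil
  | .snoc Ms N, f => .snoc (Ms.crename f) (N.crename f)
  | .snocW Ms i, f => .snocW (Ms.crename f) i
end

/-! ### Renaming of level-`l` variables (by `f`) and level-`l` weakening variables (by `g`) -/

mutual
def Tm.rename : Tm B → ℕ → (ℕ → ℕ) → (ℕ → ℕ) → Tm B
  | .var x, l, f, _ => if l = 1 then .var (f x) else .var x
  | .lam T M, l, f, g => .lam T (M.rename l (if l = 1 then up f else f) g)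
  | .app M N, l, f, g => .app (M.rename l f g) (N.rename l f g)
  | .quo Γ M, l, f, g => .quo Γ (M.rename (l + 1) f g)
  | .unq k M Ns, l, f, g =>
      .unq k (if l ≤ k then M else M.rename (l - k) f g) (Ns.rename l f g)
  | .cabs M, l, f, g => .cabs (M.rename l f g)
  | .capp M Ss, l, f, g => .capp (M.rename l f g) Ss
def TmSeq.rename : TmSeq B → ℕ → (ℕ → ℕ) → (ℕ → ℕ) → TmSeq B
  | .nil, _, _, _ => .nil
  | .snoc Ms N, l, f, g => .snoc (Ms.rename l f g) (N.rename l f g)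
  | .snocW Ms i, l, f, g => .snocW (Ms.rename l f g) (if l = 1 then g i else i)
end

/-! ### Term substitution -/

/-- Concatenation of type sequences. -/
def TySeq.append (Ss : TySeq B) : TySeq B → TySeq B
  | .nil => Ss
  | .snoc Ts T => .snoc (Ss.append Ts) T
  | .snocC Ts γ => .snocC (Ss.append Ts) γ

/-- Concatenation of term sequences. -/
def TmSeq.append (Ms : TmSeq B) : TmSeq B → TmSeq B
  | .nil => Ms
  | .snoc Ns N => .snoc (Ms.append Ns) N
  | .snocW Ns i => .snocW (Ms.append Ns) i

/-- Substitution contents, as simultaneous substitutions: a term for every variable and a term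
sequence for every weakening variable. A finite content `σ` is obtained from the identity `Sub.id`
by the extensions `σ, M/x` (`Sub.consT`) and `σ, M⃗/i` (`Sub.consW`). -/
structure Sub (B : Type u) : Type u where
  tm : ℕ → Tm B
  wk : ℕ → TmSeq B

/-- The identity substitution. -/
def Sub.id : Sub B := ⟨fun x => .var x, fun i => .snocW .nil i⟩

/-- `σ, M/x` -/
def Sub.consT (σ : Sub B) (M : Tm B) : Sub B :=
  ⟨fun | 0 => M | x + 1 => σ.tm x, σ.wk⟩

/-- `σ, M⃗/i` -/
def Sub.consW (σ : Sub B) (Ms : TmSeq B) : Sub B :=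
  ⟨σ.tm, fun | 0 => Ms | i + 1 => σ.wk i⟩

/-- Weakening of the contents of `σ` by `a` new variables and `b` new weakening variables. -/
def Sub.shift (σ : Sub B) (a b : ℕ) : Sub B :=
  ⟨fun x => (σ.tm x).rename 1 (· + a) (· + b), fun i => (σ.wk i).rename 1 (· + a) (· + b)⟩

/-- Passage of `σ` under the binder of a variable of the level of `σ`. -/
def Sub.liftT (σ : Sub B) : Sub B := (σ.shift 1 0).consT (.var 0)

/-- Passage of `σ` under the binder of a context variable. -/
def Sub.liftC (σ : Sub B) : Sub B :=
  ⟨fun x => (σ.tm x).crename Nat.succ, fun i => (σ.wk i).crename Nat.succ⟩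

mutual
/-- Capture-avoiding term substitution `M[σ]_l`, for `l ≥ 1`. -/
def Tm.subst : Tm B → ℕ → Sub B → Tm B
  | .var x, l, σ => if l = 1 then σ.tm x else .var x
  | .lam T M, l, σ => .lam T (M.subst l (if l = 1 then σ.liftT else σ))
  | .app M N, l, σ => .app (M.subst l σ) (N.subst l σ)
  | .quo Γ M, l, σ => .quo Γ (M.subst (l + 1) σ)
  | .unq k M Ns, l, σ =>
      .unq k (if l ≤ k then M else M.subst (l - k) σ) (Ns.subst l σ)
  | .cabs M, l, σ => .cabs (M.subst l σ.liftC)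
  | .capp M Ss, l, σ => .capp (M.subst l σ) Ss
/-- Term substitution on sequences; the sequence put for a weakening variable is spliced in. -/
def TmSeq.subst : TmSeq B → ℕ → Sub B → TmSeq B
  | .nil, _, _ => .nil
  | .snoc Ms N, l, σ => .snoc (Ms.subst l σ) (N.subst l σ)
  | .snocW Ms i, l, σ =>
      (Ms.subst l σ).append (if l = 1 then σ.wk i else .snocW .nil i)
end

/-! ### Level substitution

`M ↑^n_l` takes `M` from the stack `Ψ; Γ_0; Δ_1; …; Δ_l` to the stack
`Ψ; Γ_0; …; Γ_{n-1}; (Γ_n, Δ_1); Δ_2; …; Δ_l`. With names, it changes the levels of unquotations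
only. With indices, there is one more thing to do: if `n = 0`, the subterms that lived in
`Ψ; Γ_0` are moved to `Ψ; (Γ_0, Δ_1)`, so that their level-1 indices have to be shifted past the
`a` variables and the `b` weakening variables of `Δ_1`. -/

mutual
/-- Level substitution `M ↑^n_l`, for `l ≥ 1`, where `Δ_1` has `a` variables and `b` weakening
variables. -/
def Tm.levelSubst : Tm B → (n l a b : ℕ) → Tm B
  | .var x, _, _, _, _ => .var x
  | .lam T M, n, l, a, b => .lam T (M.levelSubst n l (if l = 1 then a + 1 else a) b)
  | .app M N, n, l, a, b => .app (M.levelSubst n l a b) (N.levelSubst n l a b)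
  | .quo Γ M, n, l, a, b => .quo Γ (M.levelSubst n (l + 1) a b)
  | .unq k M Ns, n, l, a, b =>
      if l ≤ k then
        .unq (k + n - 1) (if n = 0 ∧ k = l then M.rename 1 (· + a) (· + b) else M)
          (Ns.levelSubst n l a b)
      else .unq k (M.levelSubst n (l - k) a b) (Ns.levelSubst n l a b)
  | .cabs M, n, l, a, b => .cabs (M.levelSubst n l a b)
  | .capp M Ss, n, l, a, b => .capp (M.levelSubst n l a b) Ss
def TmSeq.levelSubst : TmSeq B → (n l a b : ℕ) → TmSeq B
  | .nil, _, _, _, _ => .nil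
  | .snoc Ms N, n, l, a, b => .snoc (Ms.levelSubst n l a b) (N.levelSubst n l a b)
  | .snocW Ms i, n, l, a, b => .snocW (Ms.levelSubst n l a b) i
end

/-! ### Domain and range of a context -/

/-- `dom Γ`, as a term sequence of (weakening) variables. -/
def Ctx.dom : Ctx B → TmSeq B
  | [] => .nil
  | .ty _ :: Γ => .snoc ((Ctx.dom Γ).rename 1 (· + 1) (· + 0)) (.var 0)
  | .cv _ :: Γ => .snocW ((Ctx.dom Γ).rename 1 (· + 0) (· + 1)) 0

/-- `rg Γ`. -/
def Ctx.rg : Ctx B → TySeq B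
  | [] => .nil
  | .ty T :: Γ => .snoc (Ctx.rg Γ) T
  | .cv γ :: Γ => .snocC (Ctx.rg Γ) γ

/-- The types of the variables of `Γ`, from right to left. -/
def Ctx.tys (Γ : Ctx B) : List (Ty B) :=
  Γ.filterMap fun | .ty T => some T | .cv _ => none

/-- The context variables assigned to the weakening variables of `Γ`, from right to left. -/
def Ctx.cvs (Γ : Ctx B) : List ℕ :=
  Γ.filterMap fun | .ty _ => none | .cv γ => some γ

/-! ### Context substitution -/

/-- Simultaneous context substitutions: a type sequence for every context variable. -/
abbrev CSub (B : Type u) : Type u := ℕ → TySeq B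

/-- The substitution `[S⃗/γ]` for the context variable `γ` bound last: it removes the index `0`
and fixes all other context variables. -/
def CSub.single (Ss : TySeq B) : CSub B
  | 0 => Ss
  | δ + 1 => .snocC .nil δ

/-- Passage of a context substitution under the binder of a context variable. -/
def CSub.lift (s : CSub B) : CSub B
  | 0 => .snocC .nil 0
  | δ + 1 => (s δ).crename Nat.succ

mutual
/-- Context substitution on types. -/
def Ty.csubst : Ty B → CSub B → Ty B
  | .base τ, _ => .base τ
  | .arr S T, s => .arr (S.csubst s) (T.csubst s)
  | .box Ss T, s => .box (Ss.csubst s) (T.csubst s)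
  | .all T, s => .all (T.csubst s.lift)
/-- Context substitution on type sequences. -/
def TySeq.csubst : TySeq B → CSub B → TySeq B
  | .nil, _ => .nil
  | .snoc Ss T, s => .snoc (Ss.csubst s) (T.csubst s)
  | .snocC Ss γ, s => (Ss.csubst s).append (s γ)
end

/-- `genSym S⃗`: a context of fresh (weakening) variables with range `S⃗`. -/
def genSym : TySeq B → Ctx B
  | .nil => []
  | .snoc Ss T => .ty T :: genSym Ss
  | .snocC Ss γ => .cv γ :: genSym Ss

/-- The context part of `weaken`: every entry `i : γ` is replaced by fresh (weakening) variables
for the sequence put for `γ`. When `γ` is kept as `δ`, this is again a single entry `i : δ`. -/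
def weakenCtx (s : CSub B) : Ctx B → Ctx B
  | [] => []
  | .ty T :: Γ => .ty (T.csubst s) :: weakenCtx s Γ
  | .cv γ :: Γ => genSym (s γ) ++ weakenCtx s Γ

/-- The substitution part of `weaken`: the weakening variable of every entry `i : γ` is sent to
the sequence of the fresh (weakening) variables that replace it. -/
def weakenSub (s : CSub B) : Ctx B → Sub B
  | [] => Sub.id
  | .ty _ :: Γ => (weakenSub s Γ).liftT
  | .cv γ :: Γ =>
      ((weakenSub s Γ).shift (Ctx.tys (genSym (s γ))).length
        (Ctx.cvs (genSym (s γ))).length).consW (Ctx.dom (genSym (s γ)))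

mutual
/-- Context substitution on terms. -/
def Tm.csubst : Tm B → CSub B → Tm B
  | .var x, _ => .var x
  | .lam T M, s => .lam (T.csubst s) (M.csubst s)
  | .app M N, s => .app (M.csubst s) (N.csubst s)
  | .quo Γ M, s => .quo (weakenCtx s Γ) ((M.csubst s).subst 1 (weakenSub s Γ))
  | .unq n M Ns, s => .unq n (M.csubst s) (Ns.csubst s)
  | .cabs M, s => .cabs (M.csubst s.lift)
  | .capp M Ss, s => .capp (M.csubst s) (Ss.csubst s)
/-- Context substitution on term sequences. -/
def TmSeq.csubst : TmSeq B → CSub B → TmSeq B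
  | .nil, _ => .nil
  | .snoc Ms N, s => .snoc (Ms.csubst s) (N.csubst s)
  | .snocW Ms i, s => .snocW (Ms.csubst s) i
end

/-! ### Typing -/

/-- The four variants of the calculus. -/
inductive Variant
  | K | T | K4 | S4

/-- The unquotation levels that a variant admits. -/
def Variant.Admits : Variant → ℕ → Prop
  | .K, n => n = 1
  | .T, n => n = 0 ∨ n = 1
  | .K4, n => 1 ≤ n
  | .S4, _ => True

mutual
/-- `HasTy A Ψ M T` is the judgment `Ψ ⊢ M : T` of variant `A`. In `unq`, `Ψ.drop n` is what
remains of the stack below its `n` topmost contexts; the stack of an unquotation is required to be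
nonempty, which is a restriction for `n = 0` only. In `poly`, the bound context variable is the
index `0` of `M` and does not occur in the renamed stack. -/
inductive HasTy (A : Variant) : Stack B → Tm B → Ty B → Prop
  | var {Ψ : Stack B} {Γ : Ctx B} {x : ℕ} {T : Ty B} :
      (Ctx.tys Γ)[x]? = some T → HasTy A (Γ :: Ψ) (.var x) T
  | lam {Ψ : Stack B} {Γ : Ctx B} {T S : Ty B} {M : Tm B} :
      HasTy A ((.ty T :: Γ) :: Ψ) M S → HasTy A (Γ :: Ψ) (.lam T M) (.arr T S)
  | app {Ψ : Stack B} {Γ : Ctx B} {T S : Ty B} {M N : Tm B} :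
      HasTy A (Γ :: Ψ) M (.arr T S) → HasTy A (Γ :: Ψ) N T → HasTy A (Γ :: Ψ) (.app M N) S
  | quo {Ψ : Stack B} {Γ : Ctx B} {T : Ty B} {M : Tm B} :
      HasTy A (Γ :: Ψ) M T → HasTy A Ψ (.quo Γ M) (.box (Ctx.rg Γ) T)
  | unq {Ψ : Stack B} {n : ℕ} {Ts : TySeq B} {S : Ty B} {M : Tm B} {Ns : TmSeq B} :
      A.Admits n → n ≤ Ψ.length → Ψ ≠ [] →
      HasTy A (Ψ.drop n) M (.box Ts S) → HasSeq A Ψ Ns Ts → HasTy A Ψ (.unq n M Ns) S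
  | poly {Ψ : Stack B} {T : Ty B} {M : Tm B} :
      HasTy A (Ψ.crename Nat.succ) M T → HasTy A Ψ (.cabs M) (.all T)
  | inst {Ψ : Stack B} {T : Ty B} {M : Tm B} {Ss : TySeq B} :
      HasTy A Ψ M (.all T) → HasTy A Ψ (.capp M Ss) (T.csubst (CSub.single Ss))
/-- `HasSeq A Ψ Ms Ts` is the sequence judgment `Ψ ⊢ M⃗ : T⃗` of variant `A`. -/
inductive HasSeq (A : Variant) : Stack B → TmSeq B → TySeq B → Prop
  | unit {Ψ : Stack B} : HasSeq A Ψ .nil .nil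
  | seq {Ψ : Stack B} {Ns : TmSeq B} {Ss : TySeq B} {M : Tm B} {T : Ty B} :
      HasSeq A Ψ Ns Ss → HasTy A Ψ M T → HasSeq A Ψ (.snoc Ns M) (.snoc Ss T)
  | seqC {Ψ : Stack B} {Γ : Ctx B} {Ms : TmSeq B} {Ss : TySeq B} {i γ : ℕ} :
      HasSeq A (Γ :: Ψ) Ms Ss → (Ctx.cvs Γ)[i]? = some γ →
      HasSeq A (Γ :: Ψ) (.snocW Ms i) (.snocC Ss γ)
end

/-! ### Reduction and expansion -/

/-- The partially defined substitution `M⃗/Γ`; (weakening) variables beyond `Γ` are fixed. -/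
def Sub.ofSeq : TmSeq B → Ctx B → Option (Sub B)
  | .nil, [] => some Sub.id
  | .snoc Ms N, .ty _ :: Γ => (Sub.ofSeq Ms Γ).map (fun σ => σ.consT N)
  | .snocW Ms i, .cv _ :: Γ => (Sub.ofSeq Ms Γ).map (fun σ => σ.consW (.snocW .nil i))
  | _, _ => none

mutual
/-- One-step beta-reduction of terms. -/
inductive Beta : Tm B → Tm B → Prop
  | arr (T : Ty B) (M N : Tm B) :
      Beta (.app (.lam T M) N) (M.subst 1 (Sub.id.consT N))
  | box (n : ℕ) (Γ : Ctx B) (M : Tm B) (Ns : TmSeq B) (σ : Sub B) :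
      Sub.ofSeq Ns Γ = some σ →
      Beta (.unq n (.quo Γ M) Ns)
        ((M.levelSubst n 1 (Ctx.tys Γ).length (Ctx.cvs Γ).length).subst 1 σ)
  | all (M : Tm B) (Ss : TySeq B) :
      Beta (.capp (.cabs M) Ss) (M.csubst (CSub.single Ss))
  | lam {T : Ty B} {M M' : Tm B} : Beta M M' → Beta (.lam T M) (.lam T M')
  | appL {M M' N : Tm B} : Beta M M' → Beta (.app M N) (.app M' N)
  | appR {M N N' : Tm B} : Beta N N' → Beta (.app M N) (.app M N')
  | quo {Γ : Ctx B} {M M' : Tm B} : Beta M M' → Beta (.quo Γ M) (.quo Γ M')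
  | unqL {n : ℕ} {M M' : Tm B} {Ns : TmSeq B} : Beta M M' → Beta (.unq n M Ns) (.unq n M' Ns)
  | unqR {n : ℕ} {M : Tm B} {Ns Ns' : TmSeq B} :
      BetaSeq Ns Ns' → Beta (.unq n M Ns) (.unq n M Ns')
  | cabs {M M' : Tm B} : Beta M M' → Beta (.cabs M) (.cabs M')
  | capp {M M' : Tm B} {Ss : TySeq B} : Beta M M' → Beta (.capp M Ss) (.capp M' Ss)
/-- Beta-reduction of one term of a sequence. -/
inductive BetaSeq : TmSeq B → TmSeq B → Prop
  | last {Ms : TmSeq B} {N N' : Tm B} : Beta N N' → BetaSeq (.snoc Ms N) (.snoc Ms N')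
  | init {Ms Ms' : TmSeq B} {N : Tm B} : BetaSeq Ms Ms' → BetaSeq (.snoc Ms N) (.snoc Ms' N)
  | initW {Ms Ms' : TmSeq B} {i : ℕ} : BetaSeq Ms Ms' → BetaSeq (.snocW Ms i) (.snocW Ms' i)
end

mutual
/-- `Eta A Ψ M N`: one-step eta-expansion of `M` to `N` under the context stack `Ψ`. The expansion
rules depend on the type of the expanded subterm, under the context stack at its occurrence, which
the congruence rules keep track of. -/
inductive Eta (A : Variant) : Stack B → Tm B → Tm B → Prop
  | arr {Ψ : Stack B} {M : Tm B} {T S : Ty B} :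
      HasTy A Ψ M (.arr T S) →
      Eta A Ψ M (.lam T (.app (M.rename 1 (· + 1) (· + 0)) (.var 0)))
  | box {Ψ : Stack B} {M : Tm B} {Ts : TySeq B} {S : Ty B} {Γ : Ctx B} :
      HasTy A Ψ M (.box Ts S) → Ctx.rg Γ = Ts →
      Eta A Ψ M (.quo Γ (.unq 1 M (Ctx.dom Γ)))
  | all {Ψ : Stack B} {M : Tm B} {S : Ty B} :
      HasTy A Ψ M (.all S) →
      Eta A Ψ M (.cabs (.capp (M.crename Nat.succ) (.snocC .nil 0)))
  | lam {Ψ : Stack B} {Γ : Ctx B} {T : Ty B} {M M' : Tm B} :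
      Eta A ((.ty T :: Γ) :: Ψ) M M' → Eta A (Γ :: Ψ) (.lam T M) (.lam T M')
  | appL {Ψ : Stack B} {M M' N : Tm B} : Eta A Ψ M M' → Eta A Ψ (.app M N) (.app M' N)
  | appR {Ψ : Stack B} {M N N' : Tm B} : Eta A Ψ N N' → Eta A Ψ (.app M N) (.app M N')
  | quo {Ψ : Stack B} {Γ : Ctx B} {M M' : Tm B} :
      Eta A (Γ :: Ψ) M M' → Eta A Ψ (.quo Γ M) (.quo Γ M')
  | unqL {Ψ : Stack B} {n : ℕ} {M M' : Tm B} {Ns : TmSeq B} :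
      n ≤ Ψ.length → Eta A (Ψ.drop n) M M' → Eta A Ψ (.unq n M Ns) (.unq n M' Ns)
  | unqR {Ψ : Stack B} {n : ℕ} {M : Tm B} {Ns Ns' : TmSeq B} :
      EtaSeq A Ψ Ns Ns' → Eta A Ψ (.unq n M Ns) (.unq n M Ns')
  | cabs {Ψ : Stack B} {M M' : Tm B} :
      Eta A (Ψ.crename Nat.succ) M M' → Eta A Ψ (.cabs M) (.cabs M')
  | capp {Ψ : Stack B} {M M' : Tm B} {Ss : TySeq B} :
      Eta A Ψ M M' → Eta A Ψ (.capp M Ss) (.capp M' Ss)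
/-- Eta-expansion of one term of a sequence under the context stack `Ψ`. -/
inductive EtaSeq (A : Variant) : Stack B → TmSeq B → TmSeq B → Prop
  | last {Ψ : Stack B} {Ms : TmSeq B} {N N' : Tm B} :
      Eta A Ψ N N' → EtaSeq A Ψ (.snoc Ms N) (.snoc Ms N')
  | init {Ψ : Stack B} {Ms Ms' : TmSeq B} {N : Tm B} :
      EtaSeq A Ψ Ms Ms' → EtaSeq A Ψ (.snoc Ms N) (.snoc Ms' N)
  | initW {Ψ : Stack B} {Ms Ms' : TmSeq B} {i : ℕ} :
      EtaSeq A Ψ Ms Ms' → EtaSeq A Ψ (.snocW Ms i) (.snocW Ms' i)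
end

end CtxModal

namespace CtxModal

universe u

variable {B : Type u}

/-! ### Type sequences and the algebra of context renamings and substitutions -/

-- Each of the three β-redexes reduces to a substitution lemma, and β then follows by induction on
-- the reduction step with inversion of typing. Function application uses term substitution
-- (`GHasTy.subst`). Unquotation of a quotation uses level substitution (`GHasTy.levelSubst`), which
-- merges the quoted context with the topmost context of the target stack, followed by term
-- substitution of the arguments (`GSub.ofSeq`). Instantiation uses context substitution
-- (`GHasTy.csubst`).
--
-- The obstacle is context substitution on a quotation. It first substitutes in the body and only
-- then replaces each weakening variable `i : γ` by fresh names. In between, `i` stands for a whole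
-- type sequence, so no ordinary context types the body. The judgment `GHasTy` therefore lets
-- contexts assign type sequences to weakening variables. It agrees with `HasTy` on ordinary stacks
-- (`HasTy.toG`, `GHasTy.ofG`), and all substitution lemmas are proved for it. `GSub.weakenSub` then
-- leads from the intermediate context back to an ordinary one.
--
-- For η, types are unique (`HasTy.unique`), so the type that licenses the expansion is the given
-- one. The expanded term is typed by weakening, by the typing of `Ctx.dom`, or by renaming context
-- variables. Expansion at an arrow type needs a nonempty stack: under the empty stack every type
-- has the form `∀ … ∀. [S⃗] T` (`HasTy.isPolyBox_of_nil`).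

theorem TySeq.nil_append : ∀ Ss : TySeq B, TySeq.nil.append Ss = Ss
  | .nil => rfl
  | .snoc Ss T => by simp [TySeq.append, TySeq.nil_append Ss]
  | .snocC Ss γ => by simp [TySeq.append, TySeq.nil_append Ss]

theorem TySeq.append_assoc (Rs Ss : TySeq B) :
    ∀ Ts : TySeq B, (Rs.append Ss).append Ts = Rs.append (Ss.append Ts)
  | .nil => rfl
  | .snoc Ts T => by simp [TySeq.append, TySeq.append_assoc Rs Ss Ts]
  | .snocC Ts γ => by simp [TySeq.append, TySeq.append_assoc Rs Ss Ts]

theorem TySeq.crename_append (Ss : TySeq B) (f : ℕ → ℕ) :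
    ∀ Ts : TySeq B, (Ss.append Ts).crename f = (Ss.crename f).append (Ts.crename f)
  | .nil => by simp [TySeq.append, TySeq.crename]
  | .snoc Ts T => by simp [TySeq.append, TySeq.crename, TySeq.crename_append Ss f Ts]
  | .snocC Ts γ => by simp [TySeq.append, TySeq.crename, TySeq.crename_append Ss f Ts]

theorem TySeq.csubst_append (Ss : TySeq B) (s : CSub B) :
    ∀ Ts : TySeq B, (Ss.append Ts).csubst s = (Ss.csubst s).append (Ts.csubst s)
  | .nil => by simp [TySeq.append, TySeq.csubst]
  | .snoc Ts T => by simp [TySeq.append, TySeq.csubst, TySeq.csubst_append Ss s Ts]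
  | .snocC Ts γ => by
      simp [TySeq.append, TySeq.csubst, TySeq.csubst_append Ss s Ts, TySeq.append_assoc]

theorem up_comp_up (f g : ℕ → ℕ) : up g ∘ up f = up (g ∘ f) := by
  funext k; cases k <;> rfl

mutual
-- The composition laws are built up in the order renaming-renaming, substitution after renaming,
-- renaming after substitution, substitution-substitution, because `CSub.lift` renames: the `∀` case
-- of a later law rests on earlier ones.
theorem Ty.crename_crename : ∀ (T : Ty B) (f g : ℕ → ℕ),
    (T.crename f).crename g = T.crename (g ∘ f)
  | .base τ, f, g => by simp [Ty.crename]
  | .arr S T, f, g => by simp [Ty.crename, Ty.crename_crename S, Ty.crename_crename T]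
  | .box Ss T, f, g => by simp [Ty.crename, TySeq.crename_crename Ss, Ty.crename_crename T]
  | .all T, f, g => by simp [Ty.crename, Ty.crename_crename T, up_comp_up]
theorem TySeq.crename_crename : ∀ (Ss : TySeq B) (f g : ℕ → ℕ),
    (Ss.crename f).crename g = Ss.crename (g ∘ f)
  | .nil, f, g => by simp [TySeq.crename]
  | .snoc Ss T, f, g => by
      simp [TySeq.crename, TySeq.crename_crename Ss, Ty.crename_crename T]
  | .snocC Ss γ, f, g => by simp [TySeq.crename, TySeq.crename_crename Ss]
end

theorem CSub.lift_comp_up (s : CSub B) (f : ℕ → ℕ) :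
    (fun δ => s.lift (up f δ)) = CSub.lift (fun δ => s (f δ)) := by
  funext k; cases k <;> rfl

mutual
theorem Ty.csubst_crename : ∀ (T : Ty B) (f : ℕ → ℕ) (s : CSub B),
    (T.crename f).csubst s = T.csubst (fun δ => s (f δ))
  | .base τ, f, s => by simp [Ty.crename, Ty.csubst]
  | .arr S T, f, s => by
      simp [Ty.crename, Ty.csubst, Ty.csubst_crename S, Ty.csubst_crename T]
  | .box Ss T, f, s => by
      simp [Ty.crename, Ty.csubst, TySeq.csubst_crename Ss, Ty.csubst_crename T]
  | .all T, f, s => by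
      simp [Ty.crename, Ty.csubst, Ty.csubst_crename T, CSub.lift_comp_up]
theorem TySeq.csubst_crename : ∀ (Ss : TySeq B) (f : ℕ → ℕ) (s : CSub B),
    (Ss.crename f).csubst s = Ss.csubst (fun δ => s (f δ))
  | .nil, f, s => by simp [TySeq.crename, TySeq.csubst]
  | .snoc Ss T, f, s => by
      simp [TySeq.crename, TySeq.csubst, TySeq.csubst_crename Ss, Ty.csubst_crename T]
  | .snocC Ss γ, f, s => by
      simp [TySeq.crename, TySeq.csubst, TySeq.csubst_crename Ss]
end

theorem CSub.lift_crename_up (s : CSub B) (f : ℕ → ℕ) :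
    (fun δ => (s.lift δ).crename (up f)) = CSub.lift (fun δ => (s δ).crename f) := by
  funext k
  cases k with
  | zero => simp [CSub.lift, TySeq.crename, up]
  | succ k =>
    simp only [CSub.lift, TySeq.crename_crename]
    rfl

mutual
theorem Ty.crename_csubst : ∀ (T : Ty B) (s : CSub B) (f : ℕ → ℕ),
    (T.csubst s).crename f = T.csubst (fun δ => (s δ).crename f)
  | .base τ, s, f => by simp [Ty.crename, Ty.csubst]
  | .arr S T, s, f => by
      simp [Ty.crename, Ty.csubst, Ty.crename_csubst S, Ty.crename_csubst T]
  | .box Ss T, s, f => by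
      simp [Ty.crename, Ty.csubst, TySeq.crename_csubst Ss, Ty.crename_csubst T]
  | .all T, s, f => by
      simp [Ty.crename, Ty.csubst, Ty.crename_csubst T, CSub.lift_crename_up]
theorem TySeq.crename_csubst : ∀ (Ss : TySeq B) (s : CSub B) (f : ℕ → ℕ),
    (Ss.csubst s).crename f = Ss.csubst (fun δ => (s δ).crename f)
  | .nil, s, f => by simp [TySeq.crename, TySeq.csubst]
  | .snoc Ss T, s, f => by
      simp [TySeq.crename, TySeq.csubst, TySeq.crename_csubst Ss, Ty.crename_csubst T]
  | .snocC Ss γ, s, f => by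
      simp [TySeq.csubst, TySeq.crename_append, TySeq.crename_csubst Ss]
end

theorem CSub.lift_csubst_lift (s t : CSub B) :
    (fun δ => (s.lift δ).csubst t.lift) = CSub.lift (fun δ => (s δ).csubst t) := by
  funext k
  cases k with
  | zero => simp [CSub.lift, TySeq.csubst, TySeq.append]
  | succ k => simp [CSub.lift, TySeq.csubst_crename, TySeq.crename_csubst]

mutual
theorem Ty.csubst_csubst : ∀ (T : Ty B) (s t : CSub B),
    (T.csubst s).csubst t = T.csubst (fun δ => (s δ).csubst t)
  | .base τ, s, t => by simp [Ty.csubst]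
  | .arr S T, s, t => by simp [Ty.csubst, Ty.csubst_csubst S, Ty.csubst_csubst T]
  | .box Ss T, s, t => by simp [Ty.csubst, TySeq.csubst_csubst Ss, Ty.csubst_csubst T]
  | .all T, s, t => by simp [Ty.csubst, Ty.csubst_csubst T, CSub.lift_csubst_lift]
theorem TySeq.csubst_csubst : ∀ (Ss : TySeq B) (s t : CSub B),
    (Ss.csubst s).csubst t = Ss.csubst (fun δ => (s δ).csubst t)
  | .nil, s, t => by simp [TySeq.csubst]
  | .snoc Ss T, s, t => by simp [TySeq.csubst, TySeq.csubst_csubst Ss, Ty.csubst_csubst T]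
  | .snocC Ss γ, s, t => by
      simp [TySeq.csubst, TySeq.csubst_append, TySeq.csubst_csubst Ss]
end

theorem CSub.lift_id : CSub.lift (fun δ => (TySeq.nil : TySeq B).snocC δ) =
    fun δ => TySeq.nil.snocC δ := by
  funext k; cases k <;> simp [CSub.lift, TySeq.crename]

mutual
theorem Ty.csubst_id : ∀ T : Ty B, T.csubst (fun δ => .snocC .nil δ) = T
  | .base τ => by simp [Ty.csubst]
  | .arr S T => by simp [Ty.csubst, Ty.csubst_id S, Ty.csubst_id T]
  | .box Ss T => by simp [Ty.csubst, TySeq.csubst_id Ss, Ty.csubst_id T]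
  | .all T => by simp [Ty.csubst, CSub.lift_id, Ty.csubst_id T]
theorem TySeq.csubst_id : ∀ Ss : TySeq B, Ss.csubst (fun δ => .snocC .nil δ) = Ss
  | .nil => by simp [TySeq.csubst]
  | .snoc Ss T => by simp [TySeq.csubst, TySeq.csubst_id Ss, Ty.csubst_id T]
  | .snocC Ss γ => by simp [TySeq.csubst, TySeq.append, TySeq.csubst_id Ss]
end

theorem Ty.crename_succ_csubst_single (T : Ty B) (Ss : TySeq B) :
    (T.crename Nat.succ).csubst (CSub.single Ss) = T := by
  rw [Ty.csubst_crename]; exact T.csubst_id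

theorem TySeq.crename_succ_csubst_single (Ts Ss : TySeq B) :
    (Ts.crename Nat.succ).csubst (CSub.single Ss) = Ts := by
  rw [TySeq.csubst_crename]; exact Ts.csubst_id

theorem Ty.crename_csubst_single (T : Ty B) (Ss : TySeq B) (f : ℕ → ℕ) :
    (T.csubst (CSub.single Ss)).crename f =
      (T.crename (up f)).csubst (CSub.single (Ss.crename f)) := by
  rw [Ty.crename_csubst, Ty.csubst_crename]
  congr 1; funext k
  cases k <;> simp [CSub.single, up, TySeq.crename]

/-- Needed for the `inst` rule, whose result type is itself a substitution instance: an outer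
substitution has to pass through it. -/
theorem Ty.csubst_csubst_single (T : Ty B) (Ss : TySeq B) (s : CSub B) :
    (T.csubst (CSub.single Ss)).csubst s =
      (T.csubst s.lift).csubst (CSub.single (Ss.csubst s)) := by
  rw [Ty.csubst_csubst, Ty.csubst_csubst]
  congr 1; funext k
  cases k with
  | zero => simp [CSub.single, CSub.lift, TySeq.csubst, TySeq.nil_append]
  | succ k =>
    simp [CSub.single, CSub.lift, TySeq.csubst, TySeq.nil_append,
      TySeq.crename_succ_csubst_single]

/-- Instantiating a weakened `∀` at the newly bound context variable undoes the weakening; this is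
the type computation in the expansion `Λ γ. (M @ γ)`. -/
theorem Ty.csubst_single_zero (T : Ty B) :
    (T.crename (up Nat.succ)).csubst (CSub.single (.snocC .nil 0)) = T := by
  rw [Ty.csubst_crename]
  refine Eq.trans ?_ T.csubst_id
  congr 1; funext k
  cases k <;> rfl

/-! ### Typing with generalized contexts

Between the substitution of a type sequence for a context variable and the renewal of the
weakening variables, a weakening variable stands for a whole type sequence. The following typing
judgment gives types to such intermediate terms. -/

/-- A generalized context assigns types to variables and type sequences to weakening variables. -/
@[ext] structure GCtx (B : Type u) : Type u where
  tys : List (Ty B)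
  seqs : List (TySeq B)

/-- Extension by a variable. -/
def GCtx.cons (T : Ty B) (Γ : GCtx B) : GCtx B := ⟨T :: Γ.tys, Γ.seqs⟩

/-- Extension by a weakening variable. -/
def GCtx.consW (Ts : TySeq B) (Γ : GCtx B) : GCtx B := ⟨Γ.tys, Ts :: Γ.seqs⟩

/-- The extension of `Γ` by `Δ`. -/
def GCtx.append (Δ Γ : GCtx B) : GCtx B := ⟨Δ.tys ++ Γ.tys, Δ.seqs ++ Γ.seqs⟩

def GCtx.crename (f : ℕ → ℕ) (Γ : GCtx B) : GCtx B :=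
  ⟨Γ.tys.map (·.crename f), Γ.seqs.map (·.crename f)⟩

def GCtx.csubst (s : CSub B) (Γ : GCtx B) : GCtx B :=
  ⟨Γ.tys.map (·.csubst s), Γ.seqs.map (·.csubst s)⟩

/-- A context as a generalized context. -/
def Ctx.toG (Γ : Ctx B) : GCtx B := ⟨Ctx.tys Γ, (Ctx.cvs Γ).map (.snocC .nil ·)⟩

mutual
/-- Typing of terms under a stack of generalized contexts. -/
inductive GHasTy (A : Variant) : List (GCtx B) → Tm B → Ty B → Prop
  | var {Ψ : List (GCtx B)} {Γ : GCtx B} {x : ℕ} {T : Ty B} :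
      Γ.tys[x]? = some T → GHasTy A (Γ :: Ψ) (.var x) T
  | lam {Ψ : List (GCtx B)} {Γ : GCtx B} {T S : Ty B} {M : Tm B} :
      GHasTy A (Γ.cons T :: Ψ) M S → GHasTy A (Γ :: Ψ) (.lam T M) (.arr T S)
  | app {Ψ : List (GCtx B)} {Γ : GCtx B} {T S : Ty B} {M N : Tm B} :
      GHasTy A (Γ :: Ψ) M (.arr T S) → GHasTy A (Γ :: Ψ) N T → GHasTy A (Γ :: Ψ) (.app M N) S
  | quo {Ψ : List (GCtx B)} {Γ : Ctx B} {T : Ty B} {M : Tm B} :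
      GHasTy A (Ctx.toG Γ :: Ψ) M T → GHasTy A Ψ (.quo Γ M) (.box (Ctx.rg Γ) T)
  | unq {Ψ : List (GCtx B)} {n : ℕ} {Ts : TySeq B} {S : Ty B} {M : Tm B} {Ns : TmSeq B} :
      A.Admits n → n ≤ Ψ.length → Ψ ≠ [] →
      GHasTy A (Ψ.drop n) M (.box Ts S) → GHasSeq A Ψ Ns Ts → GHasTy A Ψ (.unq n M Ns) S
  | poly {Ψ : List (GCtx B)} {T : Ty B} {M : Tm B} :
      GHasTy A (Ψ.map (GCtx.crename Nat.succ)) M T → GHasTy A Ψ (.cabs M) (.all T)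
  | inst {Ψ : List (GCtx B)} {T : Ty B} {M : Tm B} {Ss : TySeq B} :
      GHasTy A Ψ M (.all T) → GHasTy A Ψ (.capp M Ss) (T.csubst (CSub.single Ss))
/-- Typing of term sequences; the sequence assigned to a weakening variable is spliced in. -/
inductive GHasSeq (A : Variant) : List (GCtx B) → TmSeq B → TySeq B → Prop
  | unit {Ψ : List (GCtx B)} : GHasSeq A Ψ .nil .nil
  | seq {Ψ : List (GCtx B)} {Ns : TmSeq B} {Ss : TySeq B} {M : Tm B} {T : Ty B} :
      GHasSeq A Ψ Ns Ss → GHasTy A Ψ M T → GHasSeq A Ψ (.snoc Ns M) (.snoc Ss T)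
  | seqC {Ψ : List (GCtx B)} {Γ : GCtx B} {Ms : TmSeq B} {Ss Ts : TySeq B} {i : ℕ} :
      GHasSeq A (Γ :: Ψ) Ms Ss → Γ.seqs[i]? = some Ts →
      GHasSeq A (Γ :: Ψ) (.snocW Ms i) (Ss.append Ts)
end

theorem Ctx.toG_ty (T : Ty B) (Γ : Ctx B) : Ctx.toG (.ty T :: Γ) = (Ctx.toG Γ).cons T := by
  simp [Ctx.toG, GCtx.cons, Ctx.tys, Ctx.cvs]

theorem Ctx.toG_cv (γ : ℕ) (Γ : Ctx B) :
    Ctx.toG (.cv γ :: Γ) = (Ctx.toG Γ).consW (.snocC .nil γ) := by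
  simp [Ctx.toG, GCtx.consW, Ctx.tys, Ctx.cvs]

theorem Ctx.toG_append (Δ Γ : Ctx B) :
    Ctx.toG (Δ ++ Γ) = (Ctx.toG Δ).append (Ctx.toG Γ) := by
  simp [Ctx.toG, GCtx.append, Ctx.tys, Ctx.cvs]

theorem Ctx.toG_crename (f : ℕ → ℕ) :
    ∀ Γ : Ctx B, Ctx.toG (Ctx.crename Γ f) = (Ctx.toG Γ).crename f
  | [] => rfl
  | .ty T :: Γ => by
      have ih := Ctx.toG_crename f Γ
      simp only [Ctx.crename, List.map_cons, Entry.crename, Ctx.toG_ty] at ih ⊢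
      rw [ih]; rfl
  | .cv γ :: Γ => by
      have ih := Ctx.toG_crename f Γ
      simp only [Ctx.crename, List.map_cons, Entry.crename, Ctx.toG_cv] at ih ⊢
      rw [ih]; simp [GCtx.consW, GCtx.crename, TySeq.crename]

theorem Stack.toG_crename (Ψ : Stack B) (f : ℕ → ℕ) :
    (Ψ.crename f).map Ctx.toG = (Ψ.map Ctx.toG).map (GCtx.crename f) := by
  simp [Stack.crename, Function.comp_def, Ctx.toG_crename]

mutual
theorem HasTy.toG {A : Variant} : ∀ {Ψ : Stack B} {M : Tm B} {T : Ty B},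
    HasTy A Ψ M T → GHasTy A (Ψ.map Ctx.toG) M T
  | _, _, _, .var h => .var h
  | _, _, _, .lam h => .lam (by have := h.toG; rwa [List.map_cons, Ctx.toG_ty] at this)
  | _, _, _, .app h k => .app h.toG k.toG
  | _, _, _, .quo h => .quo h.toG
  | _, _, _, .unq hA hn hΨ h k =>
      .unq hA (by simpa using hn) (by simpa using hΨ) (by simpa using h.toG) k.toG
  | _, _, _, .poly h => .poly (by have := h.toG; rwa [Stack.toG_crename] at this)
  | _, _, _, .inst h => .inst h.toG
theorem HasSeq.toG {A : Variant} : ∀ {Ψ : Stack B} {Ms : TmSeq B} {Ts : TySeq B},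
    HasSeq A Ψ Ms Ts → GHasSeq A (Ψ.map Ctx.toG) Ms Ts
  | _, _, _, .unit => .unit
  | _, _, _, .seq h k => .seq h.toG k.toG
  | _, _, _, .seqC (γ := γ) h hi =>
      .seqC (Ts := .snocC .nil γ) h.toG (by simp [Ctx.toG, hi])
end

mutual
-- Quotation still pushes an ordinary context, and the other rules extend by a variable, rename
-- context variables or drop contexts, so every premise of a derivation from an ordinary stack again
-- has an ordinary stack. There a weakening variable carries a one-element sequence, and splicing it
-- is exactly `HasSeq.seqC`.
theorem GHasTy.ofG_aux {A : Variant} : ∀ {Φ : List (GCtx B)} {M : Tm B} {T : Ty B},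
    GHasTy A Φ M T → ∀ Ψ : Stack B, Ψ.map Ctx.toG = Φ → HasTy A Ψ M T
  | _, _, _, .var h, Γ :: Ψ, e => by
      obtain ⟨rfl, rfl⟩ := List.cons.inj e
      exact .var h
  | _, _, _, .lam h, Γ :: Ψ, e => by
      obtain ⟨rfl, rfl⟩ := List.cons.inj e
      exact .lam (h.ofG_aux _ (by rw [List.map_cons, Ctx.toG_ty]))
  | _, _, _, .app h k, Γ :: Ψ, e => .app (h.ofG_aux _ e) (k.ofG_aux _ e)
  | _, _, _, .quo h, Ψ, e => .quo (h.ofG_aux _ (by rw [List.map_cons, e]))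
  | _, _, _, .unq hA hn hΨ h k, Ψ, e => by
      subst e
      exact .unq hA (by simpa using hn) (by simpa using hΨ) (h.ofG_aux _ List.map_drop)
        (k.ofG_aux _ rfl)
  | _, _, _, .poly h, Ψ, e => .poly (h.ofG_aux _ (by rw [Stack.toG_crename, e]))
  | _, _, _, .inst h, Ψ, e => .inst (h.ofG_aux _ e)
theorem GHasSeq.ofG_aux {A : Variant} : ∀ {Φ : List (GCtx B)} {Ms : TmSeq B} {Ts : TySeq B},
    GHasSeq A Φ Ms Ts → ∀ Ψ : Stack B, Ψ.map Ctx.toG = Φ → HasSeq A Ψ Ms Ts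
  | _, _, _, .unit, _, _ => .unit
  | _, _, _, .seq h k, Ψ, e => .seq (h.ofG_aux _ e) (k.ofG_aux _ e)
  | _, _, _, .seqC h hi, Γ :: Ψ, e => by
      have h' := h.ofG_aux _ e
      obtain ⟨rfl, rfl⟩ := List.cons.inj e
      simp only [Ctx.toG, List.getElem?_map, Option.map_eq_some_iff] at hi
      obtain ⟨γ, hγ, rfl⟩ := hi
      exact .seqC h' hγ
end

theorem GHasTy.ofG {A : Variant} {Ψ : Stack B} {M : Tm B} {T : Ty B}
    (h : GHasTy A (Ψ.map Ctx.toG) M T) : HasTy A Ψ M T :=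
  h.ofG_aux Ψ rfl

/-- This types the splicing that occurs when a term sequence is substituted for a weakening
variable. -/
theorem GHasSeq.append {A : Variant} {Ψ : List (GCtx B)} {Ms : TmSeq B} {Ss : TySeq B}
    (h : GHasSeq A Ψ Ms Ss) : ∀ {Ns : TmSeq B} {Ts : TySeq B},
    GHasSeq A Ψ Ns Ts → GHasSeq A Ψ (Ms.append Ns) (Ss.append Ts)
  | _, _, .unit => h
  | _, _, .seq k k' => .seq (h.append k) k'
  | _, _, .seqC k hi => by
      rw [← TySeq.append_assoc]; exact .seqC (h.append k) hi

/-! ### Renaming of variables and weakening variables -/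

/-- `(f, g)` maps the entries of `Γ` to entries of `Γ'`. -/
structure GRen (f g : ℕ → ℕ) (Γ Γ' : GCtx B) : Prop where
  tm : ∀ {x T}, Γ.tys[x]? = some T → Γ'.tys[f x]? = some T
  wk : ∀ {i Ts}, Γ.seqs[i]? = some Ts → Γ'.seqs[g i]? = some Ts

theorem GRen.cons {f g : ℕ → ℕ} {Γ Γ' : GCtx B} (r : GRen f g Γ Γ') (T : Ty B) :
    GRen (up f) g (Γ.cons T) (Γ'.cons T) where
  tm {x S} h := by
    cases x with
    | zero => exact h
    | succ x => simp only [GCtx.cons, up, List.getElem?_cons_succ] at h ⊢; exact r.tm h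
  wk h := r.wk h

theorem GRen.crename {f g : ℕ → ℕ} {Γ Γ' : GCtx B} (r : GRen f g Γ Γ') (c : ℕ → ℕ) :
    GRen f g (Γ.crename c) (Γ'.crename c) where
  tm {x S} h := by
    simp only [GCtx.crename, List.getElem?_map, Option.map_eq_some_iff] at h ⊢
    obtain ⟨T, h, rfl⟩ := h
    exact ⟨T, r.tm h, rfl⟩
  wk {x S} h := by
    simp only [GCtx.crename, List.getElem?_map, Option.map_eq_some_iff] at h ⊢
    obtain ⟨T, h, rfl⟩ := h
    exact ⟨T, r.wk h, rfl⟩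

theorem GRen.append (Δ Γ : GCtx B) :
    GRen (· + Δ.tys.length) (· + Δ.seqs.length) Γ (Δ.append Γ) where
  tm h := by simpa [GCtx.append, List.getElem?_append_right] using h
  wk h := by simpa [GCtx.append, List.getElem?_append_right] using h

/-- The context at level `l` has `l - 1` contexts `Δs` above it. An unquotation over `k ≥ l` levels
removes that context too, so its body does not see the operation; for `k < l` only contexts above it
are removed, and the operation continues at level `l - k`. -/
theorem drop_append_cons_of_le {α : Type*} {Δs Ψ : List α} {a : α} {k l : ℕ}
    (hl : l = Δs.length + 1) (h : l ≤ k) : (Δs ++ a :: Ψ).drop k = Ψ.drop (k - l) := by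
  obtain ⟨m, rfl⟩ := Nat.exists_eq_add_of_le h
  subst hl
  rw [Nat.add_sub_cancel_left, List.append_cons, ← List.drop_drop, List.drop_left' (by simp)]

theorem drop_append_of_lt {α : Type*} {Δs Ψ : List α} {k l : ℕ}
    (hl : l = Δs.length + 1) (h : ¬ l ≤ k) : (Δs ++ Ψ).drop k = Δs.drop k ++ Ψ :=
  List.drop_append_of_le_length (by omega)

mutual
theorem GHasTy.rename {A : Variant} : ∀ {Φ : List (GCtx B)} {M : Tm B} {T : Ty B},
    GHasTy A Φ M T → ∀ {Δs Ψ : List (GCtx B)} {Γ Γ' : GCtx B} {l : ℕ} {f g : ℕ → ℕ},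
    Φ = Δs ++ Γ :: Ψ → l = Δs.length + 1 → GRen f g Γ Γ' →
    GHasTy A (Δs ++ Γ' :: Ψ) (M.rename l f g) T
  | _, _, _, .var h, Δs, Ψ, Γ, Γ', l, f, g, e, hl, r => by
      subst hl
      cases Δs with
      | nil =>
        obtain ⟨rfl, rfl⟩ := List.cons.inj e
        simpa [Tm.rename] using GHasTy.var (r.tm h)
      | cons Δ Δs =>
        obtain ⟨rfl, rfl⟩ := List.cons.inj e
        simpa [Tm.rename] using GHasTy.var h
  | _, _, _, .lam (T := T) (Γ := Θ) h, Δs, Ψ, Γ, Γ', l, f, g, e, hl, r => by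
      subst hl
      cases Δs with
      | nil =>
        obtain ⟨rfl, rfl⟩ := List.cons.inj e
        exact .lam (h.rename (Δs := []) rfl rfl (r.cons T))
      | cons Δ Δs =>
        obtain ⟨rfl, rfl⟩ := List.cons.inj e
        simpa [Tm.rename] using
          GHasTy.lam (h.rename (Δs := Θ.cons T :: Δs) (l := Δs.length + 1 + 1) rfl (by simp) r)
  | _, _, _, .app h k, Δs, Ψ, Γ, Γ', l, f, g, e, hl, r => by
      have h' := h.rename e hl r
      have k' := k.rename e hl r
      cases Δs <;> exact .app h' k'
  | _, _, _, .quo (Γ := Θ) h, Δs, Ψ, Γ, Γ', l, f, g, e, hl, r =>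
      .quo (h.rename (Δs := Ctx.toG Θ :: Δs) (by rw [e]; rfl) (by simp [hl]) r)
  | _, _, _, .unq (n := n) hA hn hΨ h k, Δs, Ψ, Γ, Γ', l, f, g, e, hl, r => by
      refine .unq hA (by simpa [e] using hn) (by simp) ?_ (k.rename e hl r)
      split_ifs with hk
      · rw [drop_append_cons_of_le hl hk]
        rwa [e, drop_append_cons_of_le hl hk] at h
      · rw [drop_append_of_lt hl hk]
        refine h.rename ?_ ?_ r
        · rw [e, drop_append_of_lt hl hk]
        · simp; omega
  | _, _, _, .poly h, Δs, Ψ, Γ, Γ', l, f, g, e, hl, r =>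
      .poly (by
        have := h.rename (Δs := Δs.map (GCtx.crename Nat.succ)) (l := l)
          (Ψ := Ψ.map (GCtx.crename Nat.succ)) (by simp [e]) (by simp [hl]) (r.crename Nat.succ)
        simpa using this)
  | _, _, _, .inst h, Δs, Ψ, Γ, Γ', l, f, g, e, hl, r => .inst (h.rename e hl r)
theorem GHasSeq.rename {A : Variant} : ∀ {Φ : List (GCtx B)} {Ms : TmSeq B} {Ts : TySeq B},
    GHasSeq A Φ Ms Ts → ∀ {Δs Ψ : List (GCtx B)} {Γ Γ' : GCtx B} {l : ℕ} {f g : ℕ → ℕ},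
    Φ = Δs ++ Γ :: Ψ → l = Δs.length + 1 → GRen f g Γ Γ' →
    GHasSeq A (Δs ++ Γ' :: Ψ) (Ms.rename l f g) Ts
  | _, _, _, .unit, Δs, Ψ, Γ, Γ', l, f, g, e, hl, r => .unit
  | _, _, _, .seq h k, Δs, Ψ, Γ, Γ', l, f, g, e, hl, r =>
      .seq (h.rename e hl r) (k.rename e hl r)
  | _, _, _, .seqC h hi, Δs, Ψ, Γ, Γ', l, f, g, e, hl, r => by
      have h' := h.rename e hl r
      subst hl
      cases Δs with
      | nil =>
        obtain ⟨rfl, rfl⟩ := List.cons.inj e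
        simpa [TmSeq.rename] using GHasSeq.seqC h' (r.wk hi)
      | cons Δ Δs =>
        obtain ⟨rfl, rfl⟩ := List.cons.inj e
        simpa [TmSeq.rename] using GHasSeq.seqC h' hi
end

theorem GHasTy.weaken {A : Variant} {Ψ : List (GCtx B)} {Γ : GCtx B} {M : Tm B} {T : Ty B}
    (h : GHasTy A (Γ :: Ψ) M T) (Δ : GCtx B) {a b : ℕ} (ha : a = Δ.tys.length)
    (hb : b = Δ.seqs.length) :
    GHasTy A (Δ.append Γ :: Ψ) (M.rename 1 (· + a) (· + b)) T := by
  subst ha hb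
  exact h.rename (Δs := []) rfl rfl (.append Δ Γ)

theorem GHasSeq.weaken {A : Variant} {Ψ : List (GCtx B)} {Γ : GCtx B} {Ms : TmSeq B}
    {Ts : TySeq B} (h : GHasSeq A (Γ :: Ψ) Ms Ts) (Δ : GCtx B) {a b : ℕ}
    (ha : a = Δ.tys.length) (hb : b = Δ.seqs.length) :
    GHasSeq A (Δ.append Γ :: Ψ) (Ms.rename 1 (· + a) (· + b)) Ts := by
  subst ha hb
  exact h.rename (Δs := []) rfl rfl (.append Δ Γ)

/-! ### Renaming of context variables -/

theorem Ctx.rg_crename (f : ℕ → ℕ) :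
    ∀ Γ : Ctx B, Ctx.rg (Ctx.crename Γ f) = (Ctx.rg Γ).crename f
  | [] => by simp [Ctx.crename, Ctx.rg, TySeq.crename]
  | .ty T :: Γ => congrArg (TySeq.snoc · (T.crename f)) (Ctx.rg_crename f Γ)
  | .cv γ :: Γ => congrArg (TySeq.snocC · (f γ)) (Ctx.rg_crename f Γ)

theorem GCtx.crename_append (Δ Γ : GCtx B) (f : ℕ → ℕ) :
    (Δ.append Γ).crename f = (Δ.crename f).append (Γ.crename f) := by
  simp [GCtx.append, GCtx.crename]

theorem GCtx.crename_succ_crename_up (f : ℕ → ℕ) :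
    (GCtx.crename (up f) ∘ GCtx.crename Nat.succ : GCtx B → GCtx B) =
      GCtx.crename Nat.succ ∘ GCtx.crename f := by
  funext Γ
  simp only [GCtx.crename, Function.comp_apply, List.map_map, GCtx.mk.injEq]
  constructor <;> congr 1 <;> funext T <;>
    simp only [Function.comp_apply, Ty.crename_crename, TySeq.crename_crename] <;> rfl

mutual
theorem GHasTy.crename {A : Variant} : ∀ {Ψ : List (GCtx B)} {M : Tm B} {T : Ty B},
    GHasTy A Ψ M T → ∀ f : ℕ → ℕ,
      GHasTy A (Ψ.map (GCtx.crename f)) (M.crename f) (T.crename f)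
  | _, _, _, .var h, f => .var (by simp [GCtx.crename, h])
  | _, _, _, .lam h, f => .lam (h.crename f)
  | _, _, _, .app h k, f => .app (h.crename f) (k.crename f)
  | _, _, _, .quo h, f => by
      simp only [Tm.crename, Ty.crename, ← Ctx.rg_crename]
      exact .quo (by rw [Ctx.toG_crename]; exact h.crename f)
  | _, _, _, .unq hA hn hΨ h k, f =>
      .unq hA (by simpa using hn) (by simpa using hΨ)
        (by rw [← List.map_drop]; exact h.crename f) (k.crename f)
  | _, _, _, .poly h, f => .poly (by
      have := h.crename (up f)
      rwa [List.map_map, GCtx.crename_succ_crename_up, ← List.map_map] at this)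
  | _, _, _, .inst h, f => by
      rw [Ty.crename_csubst_single]; exact .inst (h.crename f)
theorem GHasSeq.crename {A : Variant} : ∀ {Ψ : List (GCtx B)} {Ms : TmSeq B} {Ts : TySeq B},
    GHasSeq A Ψ Ms Ts → ∀ f : ℕ → ℕ,
      GHasSeq A (Ψ.map (GCtx.crename f)) (Ms.crename f) (Ts.crename f)
  | _, _, _, .unit, f => .unit
  | _, _, _, .seq h k, f => .seq (h.crename f) (k.crename f)
  | _, _, _, .seqC h hi, f => by
      rw [TySeq.crename_append]
      exact .seqC (h.crename f) (by simp [GCtx.crename, hi])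
end

/-! ### Term substitution -/

/-- `σ` is a well-typed substitution for the entries of `Γ` under the stack `Ψ; Γ'`. -/
structure GSub (A : Variant) (σ : Sub B) (Γ Γ' : GCtx B) (Ψ : List (GCtx B)) : Prop where
  tm : ∀ {x T}, Γ.tys[x]? = some T → GHasTy A (Γ' :: Ψ) (σ.tm x) T
  wk : ∀ {i Ts}, Γ.seqs[i]? = some Ts → GHasSeq A (Γ' :: Ψ) (σ.wk i) Ts

theorem GSub.id (A : Variant) (Γ : GCtx B) (Ψ : List (GCtx B)) : GSub A Sub.id Γ Γ Ψ where
  tm h := .var h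
  wk h := by have := GHasSeq.seqC (A := A) (Ψ := Ψ) .unit h; rwa [TySeq.nil_append] at this

theorem GSub.consT {A : Variant} {σ : Sub B} {Γ Γ' : GCtx B} {Ψ : List (GCtx B)}
    (s : GSub A σ Γ Γ' Ψ) {M : Tm B} {T : Ty B} (h : GHasTy A (Γ' :: Ψ) M T) :
    GSub A (σ.consT M) (Γ.cons T) Γ' Ψ where
  tm {x S} hx := by
    cases x with
    | zero => cases hx; exact h
    | succ x => exact s.tm hx
  wk h := s.wk h

theorem GSub.consW {A : Variant} {σ : Sub B} {Γ Γ' : GCtx B} {Ψ : List (GCtx B)}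
    (s : GSub A σ Γ Γ' Ψ) {Ms : TmSeq B} {Ts : TySeq B} (h : GHasSeq A (Γ' :: Ψ) Ms Ts) :
    GSub A (σ.consW Ms) (Γ.consW Ts) Γ' Ψ where
  tm h := s.tm h
  wk {x S} hx := by
    cases x with
    | zero => cases hx; exact h
    | succ x => exact s.wk hx

theorem GSub.shift {A : Variant} {σ : Sub B} {Γ Γ' : GCtx B} {Ψ : List (GCtx B)}
    (s : GSub A σ Γ Γ' Ψ) (Δ : GCtx B) {a b : ℕ} (ha : a = Δ.tys.length)
    (hb : b = Δ.seqs.length) : GSub A (σ.shift a b) Γ (Δ.append Γ') Ψ where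
  tm h := (s.tm h).weaken Δ ha hb
  wk h := (s.wk h).weaken Δ ha hb

theorem GSub.liftT {A : Variant} {σ : Sub B} {Γ Γ' : GCtx B} {Ψ : List (GCtx B)}
    (s : GSub A σ Γ Γ' Ψ) (T : Ty B) : GSub A σ.liftT (Γ.cons T) (Γ'.cons T) Ψ :=
  (s.shift ⟨[T], []⟩ rfl rfl).consT (.var rfl)

theorem GSub.liftC {A : Variant} {σ : Sub B} {Γ Γ' : GCtx B} {Ψ : List (GCtx B)}
    (s : GSub A σ Γ Γ' Ψ) : GSub A σ.liftC (Γ.crename Nat.succ) (Γ'.crename Nat.succ)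
      (Ψ.map (GCtx.crename Nat.succ)) where
  tm {x S} h := by
    simp only [GCtx.crename, List.getElem?_map, Option.map_eq_some_iff] at h
    obtain ⟨T, h, rfl⟩ := h
    exact (s.tm h).crename _
  wk {x S} h := by
    simp only [GCtx.crename, List.getElem?_map, Option.map_eq_some_iff] at h
    obtain ⟨T, h, rfl⟩ := h
    exact (s.wk h).crename _

mutual
-- The stack is given through an equation so that the induction runs over the derivation while the
-- number of contexts above the substituted one varies with quotations and unquotations.
theorem GHasTy.subst {A : Variant} : ∀ {Φ : List (GCtx B)} {M : Tm B} {T : Ty B},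
    GHasTy A Φ M T → ∀ {Δs Ψ : List (GCtx B)} {Γ Γ' : GCtx B} {l : ℕ} {σ : Sub B},
    Φ = Δs ++ Γ :: Ψ → l = Δs.length + 1 → GSub A σ Γ Γ' Ψ →
    GHasTy A (Δs ++ Γ' :: Ψ) (M.subst l σ) T
  | _, _, _, .var h, Δs, Ψ, Γ, Γ', l, σ, e, hl, s => by
      subst hl
      cases Δs with
      | nil =>
        obtain ⟨rfl, rfl⟩ := List.cons.inj e
        exact s.tm h
      | cons Δ Δs =>
        obtain ⟨rfl, rfl⟩ := List.cons.inj e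
        simpa [Tm.subst] using GHasTy.var h
  | _, _, _, .lam (T := T) (Γ := Θ) h, Δs, Ψ, Γ, Γ', l, σ, e, hl, s => by
      subst hl
      cases Δs with
      | nil =>
        obtain ⟨rfl, rfl⟩ := List.cons.inj e
        exact .lam (h.subst (Δs := []) rfl rfl (s.liftT T))
      | cons Δ Δs =>
        obtain ⟨rfl, rfl⟩ := List.cons.inj e
        simpa [Tm.subst] using
          GHasTy.lam (h.subst (Δs := Θ.cons T :: Δs) (l := Δs.length + 1 + 1) rfl (by simp) s)
  | _, _, _, .app h k, Δs, Ψ, Γ, Γ', l, σ, e, hl, s => by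
      have h' := h.subst e hl s
      have k' := k.subst e hl s
      cases Δs <;> exact .app h' k'
  | _, _, _, .quo (Γ := Θ) h, Δs, Ψ, Γ, Γ', l, σ, e, hl, s =>
      .quo (h.subst (Δs := Ctx.toG Θ :: Δs) (by rw [e]; rfl) (by simp [hl]) s)
  | _, _, _, .unq (n := n) hA hn hΨ h k, Δs, Ψ, Γ, Γ', l, σ, e, hl, s => by
      refine .unq hA (by simpa [e] using hn) (by simp) ?_ (k.subst e hl s)
      split_ifs with hk
      · rw [drop_append_cons_of_le hl hk]
        rwa [e, drop_append_cons_of_le hl hk] at h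
      · rw [drop_append_of_lt hl hk]
        refine h.subst ?_ ?_ s
        · rw [e, drop_append_of_lt hl hk]
        · simp; omega
  | _, _, _, .poly h, Δs, Ψ, Γ, Γ', l, σ, e, hl, s =>
      .poly (by
        have := h.subst (Δs := Δs.map (GCtx.crename Nat.succ)) (l := l)
          (by simp only [e, List.map_append, List.map_cons]) (by simp [hl]) s.liftC
        simpa using this)
  | _, _, _, .inst h, Δs, Ψ, Γ, Γ', l, σ, e, hl, s => .inst (h.subst e hl s)
theorem GHasSeq.subst {A : Variant} : ∀ {Φ : List (GCtx B)} {Ms : TmSeq B} {Ts : TySeq B},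
    GHasSeq A Φ Ms Ts → ∀ {Δs Ψ : List (GCtx B)} {Γ Γ' : GCtx B} {l : ℕ} {σ : Sub B},
    Φ = Δs ++ Γ :: Ψ → l = Δs.length + 1 → GSub A σ Γ Γ' Ψ →
    GHasSeq A (Δs ++ Γ' :: Ψ) (Ms.subst l σ) Ts
  | _, _, _, .unit, Δs, Ψ, Γ, Γ', l, σ, e, hl, s => .unit
  | _, _, _, .seq h k, Δs, Ψ, Γ, Γ', l, σ, e, hl, s =>
      .seq (h.subst e hl s) (k.subst e hl s)
  | _, _, _, .seqC h hi, Δs, Ψ, Γ, Γ', l, σ, e, hl, s => by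
      have h' := h.subst e hl s
      subst hl
      cases Δs with
      | nil =>
        obtain ⟨rfl, rfl⟩ := List.cons.inj e
        exact h'.append (s.wk hi)
      | cons Δ Δs =>
        obtain ⟨rfl, rfl⟩ := List.cons.inj e
        simpa [TmSeq.subst, TmSeq.append] using GHasSeq.seqC h' hi
end

/-! ### Level substitution -/

/-- The closure property that makes unquotation levels survive β in all four variants. Since `1 ≤
k`, the truncated subtraction is exact. -/
theorem Variant.Admits.add_sub_one {A : Variant} {k n : ℕ} (hk : A.Admits k) (hn : A.Admits n)
    (h : 1 ≤ k) : A.Admits (k + n - 1) := by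
  cases A <;> simp only [Variant.Admits] at * <;> omega

mutual
-- `Γ :: Ψ` is the stack of the unquotation and `Δ` the context of the quotation, typed below `n`
-- contexts. The result lives under `Γ :: Ψ` with `Δ` put on top of `Γ`; the entries of `Δ` come
-- first in the list, so their indices do not change.
theorem GHasTy.levelSubst {A : Variant} : ∀ {Φ : List (GCtx B)} {M : Tm B} {T : Ty B},
    GHasTy A Φ M T → ∀ {Δs Ψ : List (GCtx B)} {Δ Γ : GCtx B} {n l a b : ℕ},
    Φ = Δs ++ Δ :: (Γ :: Ψ).drop n → l = Δs.length + 1 → a = Δ.tys.length →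
    b = Δ.seqs.length → A.Admits n → n ≤ Ψ.length + 1 →
    GHasTy A (Δs ++ Δ.append Γ :: Ψ) (M.levelSubst n l a b) T
  | _, _, _, .var h, Δs, Ψ, Δ, Γ, n, l, a, b, e, hl, ha, hb, hA', hn' => by
      cases Δs with
      | nil =>
        obtain ⟨rfl, rfl⟩ := List.cons.inj e
        exact .var (by
          obtain ⟨hx, -⟩ := List.getElem?_eq_some_iff.1 h
          simpa [GCtx.append, List.getElem?_append_left hx] using h)
      | cons Δ' Δs =>
        obtain ⟨rfl, rfl⟩ := List.cons.inj e
        exact .var h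
  | _, _, _, .lam (T := T) (Γ := Θ) h, Δs, Ψ, Δ, Γ, n, l, a, b, e, hl, ha, hb, hA', hn' => by
      subst hl
      cases Δs with
      | nil =>
        obtain ⟨rfl, rfl⟩ := List.cons.inj e
        exact .lam (h.levelSubst (Δs := []) rfl rfl (by simp [GCtx.cons, ha]) hb hA' hn')
      | cons Δ' Δs =>
        obtain ⟨rfl, rfl⟩ := List.cons.inj e
        simpa [Tm.levelSubst] using
          GHasTy.lam (h.levelSubst (Δs := Θ.cons T :: Δs) (l := Δs.length + 1 + 1) rfl
            (by simp) ha hb hA' hn')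
  | _, _, _, .app h k, Δs, Ψ, Δ, Γ, n, l, a, b, e, hl, ha, hb, hA', hn' => by
      have h' := h.levelSubst e hl ha hb hA' hn'
      have k' := k.levelSubst e hl ha hb hA' hn'
      cases Δs <;> exact .app h' k'
  | _, _, _, .quo (Γ := Θ) h, Δs, Ψ, Δ, Γ, n, l, a, b, e, hl, ha, hb, hA', hn' =>
      .quo (h.levelSubst (Δs := Ctx.toG Θ :: Δs) (by rw [e]; rfl) (by simp [hl]) ha hb hA' hn')
  | _, _, _, .unq (n := m) hA hn hΨ h k, Δs, Ψ, Δ, Γ, n, l, a, b, e, hl, ha, hb, hA', hn' => by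
      have k' := k.levelSubst e hl ha hb hA' hn'
      have hlen : m ≤ Δs.length + 1 + (Ψ.length + 1 - n) := by
        rw [e] at hn; simp at hn; omega
      rw [Tm.levelSubst]
      split_ifs with hm hn0
      -- For `n = 0` and `k = l` the body was typed under `Γ :: Ψ` itself and now sits under the
      -- merged context, so it must be weakened by `Δ`.
      · obtain ⟨rfl, rfl⟩ := hn0
        refine .unq (hA.add_sub_one hA' (by omega)) (by simp; omega) (by simp) ?_ k'
        rw [e, drop_append_cons_of_le hl le_rfl] at h
        rw [show m + 0 - 1 = Δs.length by omega, List.drop_left]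
        simp only [Nat.sub_self, List.drop_zero] at h
        exact h.weaken Δ ha hb
      · refine .unq (hA.add_sub_one hA' (by omega)) (by simp; omega) (by simp) ?_ k'
        -- Here `n ≥ 1` or `k > l`, so the new unquotation also passes the merged context. The old
        -- stack had `Δ` removed and then `n + (k - l)` contexts of `Γ :: Ψ`; the first of these is
        -- `Γ`, which accounts for the `- 1` in the new level.
        rw [e, drop_append_cons_of_le hl hm, List.drop_drop] at h
        rw [drop_append_cons_of_le hl (by omega)]
        rwa [show n + (m - l) = m + n - 1 - l + 1 by omega, List.drop_succ_cons] at h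
      · refine .unq hA (by simp; omega) (by simp) ?_ k'
        rw [drop_append_of_lt hl hm]
        refine h.levelSubst ?_ ?_ ha hb hA' hn'
        · rw [e, drop_append_of_lt hl hm]
        · simp; omega
  | _, _, _, .poly h, Δs, Ψ, Δ, Γ, n, l, a, b, e, hl, ha, hb, hA', hn' =>
      .poly (by
        have := h.levelSubst (Δs := Δs.map (GCtx.crename Nat.succ)) (l := l) (a := a) (b := b)
          (Δ := Δ.crename Nat.succ) (Γ := Γ.crename Nat.succ)
          (Ψ := Ψ.map (GCtx.crename Nat.succ)) (n := n)
          (by rw [e, ← List.map_cons, ← List.map_drop]; simp)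
          (by simp [hl]) (by simp [ha, GCtx.crename]) (by simp [hb, GCtx.crename]) hA'
          (by simpa using hn')
        simpa [GCtx.crename_append] using this)
  | _, _, _, .inst h, Δs, Ψ, Δ, Γ, n, l, a, b, e, hl, ha, hb, hA', hn' =>
      .inst (h.levelSubst e hl ha hb hA' hn')
theorem GHasSeq.levelSubst {A : Variant} :
    ∀ {Φ : List (GCtx B)} {Ms : TmSeq B} {Ts : TySeq B},
    GHasSeq A Φ Ms Ts → ∀ {Δs Ψ : List (GCtx B)} {Δ Γ : GCtx B} {n l a b : ℕ},
    Φ = Δs ++ Δ :: (Γ :: Ψ).drop n → l = Δs.length + 1 → a = Δ.tys.length →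
    b = Δ.seqs.length → A.Admits n → n ≤ Ψ.length + 1 →
    GHasSeq A (Δs ++ Δ.append Γ :: Ψ) (Ms.levelSubst n l a b) Ts
  | _, _, _, .unit, Δs, Ψ, Δ, Γ, n, l, a, b, e, hl, ha, hb, hA', hn' => .unit
  | _, _, _, .seq h k, Δs, Ψ, Δ, Γ, n, l, a, b, e, hl, ha, hb, hA', hn' =>
      .seq (h.levelSubst e hl ha hb hA' hn') (k.levelSubst e hl ha hb hA' hn')
  | _, _, _, .seqC h hi, Δs, Ψ, Δ, Γ, n, l, a, b, e, hl, ha, hb, hA', hn' => by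
      have h' := h.levelSubst e hl ha hb hA' hn'
      cases Δs with
      | nil =>
        obtain ⟨rfl, rfl⟩ := List.cons.inj e
        exact .seqC h' (by
          obtain ⟨hx, -⟩ := List.getElem?_eq_some_iff.1 hi
          simpa [GCtx.append, List.getElem?_append_left hx] using hi)
      | cons Δ' Δs =>
        obtain ⟨rfl, rfl⟩ := List.cons.inj e
        exact .seqC h' hi
end

/-! ### Context substitution -/

theorem GHasSeq.dom (A : Variant) (Γ' : GCtx B) (Ψ : List (GCtx B)) :
    ∀ Γ : Ctx B, GHasSeq A ((Ctx.toG Γ).append Γ' :: Ψ) (Ctx.dom Γ) (Ctx.rg Γ)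
  | [] => .unit
  | .ty T :: Γ => by
      rw [Ctx.toG_ty]
      exact .seq ((GHasSeq.dom A Γ' Ψ Γ).weaken ⟨[T], []⟩ rfl rfl) (.var rfl)
  | .cv γ :: Γ => by
      rw [Ctx.toG_cv]
      exact .seqC (Ts := .snocC .nil γ)
        ((GHasSeq.dom A Γ' Ψ Γ).weaken ⟨[], [.snocC .nil γ]⟩ rfl rfl) rfl

theorem rg_genSym_append (Γ : Ctx B) :
    ∀ Ss : TySeq B, Ctx.rg (genSym Ss ++ Γ) = (Ctx.rg Γ).append Ss
  | .nil => rfl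
  | .snoc Ss T => by simp [genSym, Ctx.rg, TySeq.append, rg_genSym_append Γ Ss]
  | .snocC Ss γ => by simp [genSym, Ctx.rg, TySeq.append, rg_genSym_append Γ Ss]

theorem rg_genSym (Ss : TySeq B) : Ctx.rg (genSym Ss) = Ss := by
  simpa [Ctx.rg, TySeq.nil_append] using rg_genSym_append [] Ss

theorem rg_weakenCtx (s : CSub B) :
    ∀ Γ : Ctx B, Ctx.rg (weakenCtx s Γ) = (Ctx.rg Γ).csubst s
  | [] => by simp [weakenCtx, Ctx.rg, TySeq.csubst]
  | .ty T :: Γ => by simp [weakenCtx, Ctx.rg, TySeq.csubst, rg_weakenCtx s Γ]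
  | .cv γ :: Γ => by
      simp [weakenCtx, Ctx.rg, TySeq.csubst, rg_weakenCtx s Γ, rg_genSym_append]

/-- The step from the generalized context, where `i` stands for the sequence `s γ`, back to an
ordinary one. The fresh names of `genSym (s γ)` form a term sequence whose type is the range `s γ`,
which is what `i` has to be replaced by. -/
theorem GSub.weakenSub (A : Variant) (Ψ : List (GCtx B)) (s : CSub B) : ∀ Γ : Ctx B,
    GSub A (weakenSub s Γ) ((Ctx.toG Γ).csubst s) (Ctx.toG (weakenCtx s Γ)) Ψ
  | [] => .id A _ Ψ
  | .ty T :: Γ => by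
      simp only [weakenCtx, Ctx.toG_ty]
      exact (GSub.weakenSub A Ψ s Γ).liftT _
  | .cv γ :: Γ => by
      simp only [weakenCtx, Ctx.toG_cv, Ctx.toG_append]
      have hd := GHasSeq.dom A (Ctx.toG (weakenCtx s Γ)) Ψ (genSym (s γ))
      rw [rg_genSym] at hd
      have hs := ((GSub.weakenSub A Ψ s Γ).shift (Ctx.toG (genSym (s γ))) rfl
        (List.length_map _).symm).consW hd
      have e : ((Ctx.toG Γ).consW (.snocC .nil γ)).csubst s =
          ((Ctx.toG Γ).csubst s).consW (s γ) := by
        simp [GCtx.csubst, GCtx.consW, TySeq.csubst, TySeq.nil_append]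
      rw [e]
      exact hs

theorem GCtx.crename_succ_csubst_lift (s : CSub B) :
    (GCtx.csubst s.lift ∘ GCtx.crename Nat.succ : GCtx B → GCtx B) =
      GCtx.crename Nat.succ ∘ GCtx.csubst s := by
  funext Γ
  simp only [GCtx.crename, GCtx.csubst, Function.comp_apply, List.map_map, GCtx.mk.injEq]
  constructor <;> congr 1 <;> funext T <;>
    simp only [Function.comp_apply, Ty.csubst_crename, TySeq.csubst_crename, Ty.crename_csubst,
      TySeq.crename_csubst] <;> rfl

/-- The bound context variable does not occur in the surrounding stack, so instantiating it leaves
that stack ordinary. Hence the result of an instantiation redex can be read back by `GHasTy.ofG`. -/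
theorem GCtx.crename_succ_csubst_single (Ss : TySeq B) (Γ : GCtx B) :
    (Γ.crename Nat.succ).csubst (CSub.single Ss) = Γ := by
  simp [GCtx.crename, GCtx.csubst, Function.comp_def, Ty.crename_succ_csubst_single,
    TySeq.crename_succ_csubst_single]

mutual
theorem GHasTy.csubst {A : Variant} : ∀ {Ψ : List (GCtx B)} {M : Tm B} {T : Ty B},
    GHasTy A Ψ M T → ∀ s : CSub B,
      GHasTy A (Ψ.map (GCtx.csubst s)) (M.csubst s) (T.csubst s)
  | _, _, _, .var h, s => .var (by simp [GCtx.csubst, h])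
  | _, _, _, .lam h, s => .lam (h.csubst s)
  | _, _, _, .app h k, s => .app (h.csubst s) (k.csubst s)
  | Ψ, _, _, .quo (Γ := Γ) h, s => by
      simp only [Tm.csubst, Ty.csubst, ← rg_weakenCtx]
      -- The induction hypothesis types the body under the generalized context `(Ctx.toG Γ).csubst
      -- s`; the level-1 substitution restores the ordinary context that the quotation rule demands.
      exact .quo ((h.csubst s).subst (Δs := []) rfl rfl (.weakenSub A _ s Γ))
  | _, _, _, .unq hA hn hΨ h k, s =>
      .unq hA (by simpa using hn) (by simpa using hΨ)
        (by rw [← List.map_drop]; exact h.csubst s) (k.csubst s)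
  | _, _, _, .poly h, s => .poly (by
      have := h.csubst s.lift
      rwa [List.map_map, GCtx.crename_succ_csubst_lift, ← List.map_map] at this)
  | _, _, _, .inst h, s => by
      rw [Ty.csubst_csubst_single]; exact .inst (h.csubst s)
theorem GHasSeq.csubst {A : Variant} : ∀ {Ψ : List (GCtx B)} {Ms : TmSeq B} {Ts : TySeq B},
    GHasSeq A Ψ Ms Ts → ∀ s : CSub B,
      GHasSeq A (Ψ.map (GCtx.csubst s)) (Ms.csubst s) (Ts.csubst s)
  | _, _, _, .unit, s => .unit
  | _, _, _, .seq h k, s => .seq (h.csubst s) (k.csubst s)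
  | _, _, _, .seqC h hi, s => by
      rw [TySeq.csubst_append]
      exact .seqC (h.csubst s) (by simp [GCtx.csubst, hi])
end

/-! ### Subject reduction -/

/-- The domain is the merged context left by level substitution: the entries of `Γ` receive the
arguments, while those of `Θ` are fixed because the substitution extends the identity. -/
theorem GSub.ofSeq {A : Variant} {Ψ : Stack B} {Θ : Ctx B} : ∀ {Ns : TmSeq B} {Γ : Ctx B}
    {σ : Sub B}, HasSeq A (Θ :: Ψ) Ns (Ctx.rg Γ) → Sub.ofSeq Ns Γ = some σ →
    GSub A σ ((Ctx.toG Γ).append (Ctx.toG Θ)) (Ctx.toG Θ) (Ψ.map Ctx.toG)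
  | .nil, [], σ, _, e => by
      cases e
      exact .id A _ _
  | .snoc Ms N, .ty T :: Γ, σ, h, e => by
      simp only [Sub.ofSeq, Option.map_eq_some_iff] at e
      obtain ⟨ρ, e, rfl⟩ := e
      cases h with
      | seq h k =>
        rw [Ctx.toG_ty]
        exact (GSub.ofSeq h e).consT k.toG
  | .snocW Ms i, .cv γ :: Γ, σ, h, e => by
      simp only [Sub.ofSeq, Option.map_eq_some_iff] at e
      obtain ⟨ρ, e, rfl⟩ := e
      cases h with
      | seqC h hi =>
        rw [Ctx.toG_cv]
        exact (GSub.ofSeq h e).consW (HasSeq.toG (.seqC .unit hi))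
  | .nil, .ty _ :: _, _, _, e => by simp [Sub.ofSeq] at e
  | .nil, .cv _ :: _, _, _, e => by simp [Sub.ofSeq] at e
  | .snoc _ _, [], _, _, e => by simp [Sub.ofSeq] at e
  | .snoc _ _, .cv _ :: _, _, _, e => by simp [Sub.ofSeq] at e
  | .snocW _ _, [], _, _, e => by simp [Sub.ofSeq] at e
  | .snocW _ _, .ty _ :: _, _, _, e => by simp [Sub.ofSeq] at e

theorem HasTy.beta_arr {A : Variant} {Ψ : Stack B} {Γ : Ctx B} {T S : Ty B} {M N : Tm B}
    (h : HasTy A ((.ty T :: Γ) :: Ψ) M S) (k : HasTy A (Γ :: Ψ) N T) :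
    HasTy A (Γ :: Ψ) (M.subst 1 (Sub.id.consT N)) S := by
  have h' := h.toG
  rw [List.map_cons, Ctx.toG_ty] at h'
  exact GHasTy.ofG (h'.subst (Δs := []) rfl rfl ((GSub.id A _ _).consT k.toG))

theorem HasTy.beta_box {A : Variant} {Ψ : Stack B} {n : ℕ} {Γ : Ctx B} {S : Ty B} {M : Tm B}
    {Ns : TmSeq B} {σ : Sub B} (hA : A.Admits n) (hn : n ≤ Ψ.length) (hΨ : Ψ ≠ [])
    (h : HasTy A (Γ :: Ψ.drop n) M S) (k : HasSeq A Ψ Ns (Ctx.rg Γ))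
    (hσ : Sub.ofSeq Ns Γ = some σ) :
    HasTy A Ψ
      ((M.levelSubst n 1 (Ctx.tys Γ).length (Ctx.cvs Γ).length).subst 1 σ) S := by
  cases Ψ with
  | nil => exact absurd rfl hΨ
  | cons Θ Ψ =>
    have h' := h.toG.levelSubst (Δs := []) (Δ := Ctx.toG Γ) (Γ := Ctx.toG Θ)
      (Ψ := Ψ.map Ctx.toG) (n := n) (by simp [List.map_drop]) rfl rfl rfl hA (by simpa using hn)
    simp only [Ctx.toG, List.length_map] at h'
    exact GHasTy.ofG (h'.subst (Δs := []) rfl rfl (GSub.ofSeq k hσ))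

theorem HasTy.beta_all {A : Variant} {Ψ : Stack B} {T : Ty B} {M : Tm B}
    (h : HasTy A (Ψ.crename Nat.succ) M T) (Ss : TySeq B) :
    HasTy A Ψ (M.csubst (CSub.single Ss)) (T.csubst (CSub.single Ss)) := by
  have h' := h.toG.csubst (CSub.single Ss)
  rw [Stack.toG_crename, List.map_map] at h'
  refine GHasTy.ofG ?_
  convert h' using 1
  simp [GCtx.crename_succ_csubst_single]

theorem HasTy.quo_inv {A : Variant} {Ψ : Stack B} {Γ : Ctx B} {M : Tm B} {U : Ty B}
    (h : HasTy A Ψ (.quo Γ M) U) : ∃ T, U = .box (Ctx.rg Γ) T ∧ HasTy A (Γ :: Ψ) M T := by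
  cases h with | quo h => exact ⟨_, rfl, h⟩

mutual
theorem Beta.hasTy {A : Variant} : ∀ {M N : Tm B}, Beta M N →
    ∀ {Ψ : Stack B} {T : Ty B}, HasTy A Ψ M T → HasTy A Ψ N T
  | _, _, .arr T M N, Ψ, S, h => by
      cases h with | app h k => cases h with | lam h => exact h.beta_arr k
  | _, _, .box n Γ M Ns σ hσ, Ψ, S, h => by
      cases h with
      | unq hA hn hΨ h k =>
        obtain ⟨_, e, h⟩ := h.quo_inv
        cases e
        exact h.beta_box hA hn hΨ k hσ
  | _, _, .all M Ss, Ψ, S, h => by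
      cases h with | inst h => cases h with | poly h => exact h.beta_all Ss
  | _, _, .lam r, Ψ, S, h => by cases h with | lam h => exact .lam (r.hasTy h)
  | _, _, .appL r, Ψ, S, h => by cases h with | app h k => exact .app (r.hasTy h) k
  | _, _, .appR r, Ψ, S, h => by cases h with | app h k => exact .app h (r.hasTy k)
  | _, _, .quo r, Ψ, S, h => by cases h with | quo h => exact .quo (r.hasTy h)
  | _, _, .unqL r, Ψ, S, h => by
      cases h with | unq hA hn hΨ h k => exact .unq hA hn hΨ (r.hasTy h) k
  | _, _, .unqR r, Ψ, S, h => by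
      cases h with | unq hA hn hΨ h k => exact .unq hA hn hΨ h (r.hasSeq k)
  | _, _, .cabs r, Ψ, S, h => by cases h with | poly h => exact .poly (r.hasTy h)
  | _, _, .capp r, Ψ, S, h => by cases h with | inst h => exact .inst (r.hasTy h)
theorem BetaSeq.hasSeq {A : Variant} : ∀ {Ms Ns : TmSeq B}, BetaSeq Ms Ns →
    ∀ {Ψ : Stack B} {Ts : TySeq B}, HasSeq A Ψ Ms Ts → HasSeq A Ψ Ns Ts
  | _, _, .last r, Ψ, Ts, h => by cases h with | seq h k => exact .seq h (r.hasTy k)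
  | _, _, .init r, Ψ, Ts, h => by cases h with | seq h k => exact .seq (r.hasSeq h) k
  | _, _, .initW r, Ψ, Ts, h => by cases h with | seqC h hi => exact .seqC (r.hasSeq h) hi
end

/-! ### Subject expansion -/

/-- Typing is syntax-directed: abstractions and quotations carry their annotations, and the type of
an unquotation or application is read off its head. The arguments are never compared. -/
theorem HasTy.unique {A : Variant} : ∀ {Ψ : Stack B} {M : Tm B} {T T' : Ty B},
    HasTy A Ψ M T → HasTy A Ψ M T' → T = T'
  | _, _, _, _, .var h, .var h' => Option.some.inj (h.symm.trans h')
  | _, _, _, _, .lam h, .lam h' => by rw [h.unique h']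
  | _, _, _, _, .app h _, .app h' _ => by cases h.unique h'; rfl
  | _, _, _, _, .quo h, .quo h' => by rw [h.unique h']
  | _, _, _, _, .unq _ _ _ h _, .unq _ _ _ h' _ => by cases h.unique h'; rfl
  | _, _, _, _, .poly h, .poly h' => by rw [h.unique h']
  | _, _, _, _, .inst h, .inst h' => by cases h.unique h'; rfl

/-- The types `∀ γ_1. … ∀ γ_n. [S⃗] T`. -/
def Ty.IsPolyBox : Ty B → Prop
  | .base _ => False
  | .arr _ _ => False
  | .box _ _ => True
  | .all T => T.IsPolyBox

theorem Ty.IsPolyBox.csubst : ∀ {T : Ty B}, T.IsPolyBox → ∀ s : CSub B, (T.csubst s).IsPolyBox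
  | .box _ _, _, s => by simp [Ty.csubst, Ty.IsPolyBox]
  | .all _, h, s => by
      simp only [Ty.csubst, Ty.IsPolyBox] at h ⊢
      exact Ty.IsPolyBox.csubst h _

/-- Variables, abstractions and applications need a current context, and unquotation needs a
nonempty stack. Only quotations, `Λ` and instantiations remain, and the latter two keep the stack
empty and the shape of the type. -/
theorem HasTy.isPolyBox_of_nil {A : Variant} : ∀ {M : Tm B} {T : Ty B},
    HasTy A [] M T → T.IsPolyBox
  | _, _, .quo _ => trivial
  | _, _, .unq _ _ h _ _ => absurd rfl h
  | .cabs M, .all T, .poly h =>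
      show T.IsPolyBox from HasTy.isPolyBox_of_nil (A := A) (M := M) h
  | _, _, .inst (T := T) h =>
      Ty.IsPolyBox.csubst (show T.IsPolyBox from HasTy.isPolyBox_of_nil (T := .all T) h) _

theorem HasTy.eta_arr {A : Variant} {Ψ : Stack B} {M : Tm B} {T S : Ty B}
    (h : HasTy A Ψ M (.arr T S)) :
    HasTy A Ψ (.lam T (.app (M.rename 1 (· + 1) (· + 0)) (.var 0))) (.arr T S) := by
  cases Ψ with
  -- Without a current context the new abstraction could not be typed, but no term has an arrow type
  -- there.
  | nil => exact h.isPolyBox_of_nil.elim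
  | cons Γ Ψ =>
    have h' := h.toG.weaken (Γ := Ctx.toG Γ) ⟨[T], []⟩ rfl rfl
    exact .lam (.app (GHasTy.ofG (by rw [List.map_cons, Ctx.toG_ty]; exact h'))
      (.var (by simp [Ctx.tys])))

theorem HasTy.eta_box {A : Variant} {Ψ : Stack B} {M : Tm B} {Γ : Ctx B} {S : Ty B}
    (h : HasTy A Ψ M (.box (Ctx.rg Γ) S)) :
    HasTy A Ψ (.quo Γ (.unq 1 M (Ctx.dom Γ))) (.box (Ctx.rg Γ) S) := by
  refine .quo (.unq (by cases A <;> simp [Variant.Admits]) (by simp) (by simp) h ?_)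
  refine GHasSeq.ofG_aux ?_ _ rfl
  -- The domain is typed under `Γ` alone, so the context that it extends is empty.
  have := GHasSeq.dom A ⟨[], []⟩ (Ψ.map Ctx.toG) Γ
  simpa [GCtx.append] using this

theorem HasTy.eta_all {A : Variant} {Ψ : Stack B} {M : Tm B} {S : Ty B}
    (h : HasTy A Ψ M (.all S)) :
    HasTy A Ψ (.cabs (.capp (M.crename Nat.succ) (.snocC .nil 0))) (.all S) := by
  have h' := h.toG.crename Nat.succ
  rw [← Stack.toG_crename] at h'
  have k := HasTy.inst (Ss := .snocC .nil 0) (T := S.crename (up Nat.succ)) h'.ofG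
  rw [Ty.csubst_single_zero] at k
  exact .poly k

mutual
theorem Eta.hasTy {A : Variant} : ∀ {Ψ : Stack B} {M N : Tm B}, Eta A Ψ M N →
    ∀ {T : Ty B}, HasTy A Ψ M T → HasTy A Ψ N T
  | _, _, _, .arr r, S, h => by rw [h.unique r]; exact r.eta_arr
  | _, _, _, .box r e, S, h => by subst e; rw [h.unique r]; exact r.eta_box
  | _, _, _, .all r, S, h => by rw [h.unique r]; exact r.eta_all
  | _, _, _, .lam r, S, h => by cases h with | lam h => exact .lam (r.hasTy h)
  | _, _, _, .appL r, S, h => by cases h with | app h k => exact .app (r.hasTy h) k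
  | _, _, _, .appR r, S, h => by cases h with | app h k => exact .app h (r.hasTy k)
  | _, _, _, .quo r, S, h => by cases h with | quo h => exact .quo (r.hasTy h)
  | _, _, _, .unqL _ r, S, h => by
      cases h with | unq hA hn hΨ h k => exact .unq hA hn hΨ (r.hasTy h) k
  | _, _, _, .unqR r, S, h => by
      cases h with | unq hA hn hΨ h k => exact .unq hA hn hΨ h (r.hasSeq k)
  | _, _, _, .cabs r, S, h => by cases h with | poly h => exact .poly (r.hasTy h)
  | _, _, _, .capp r, S, h => by cases h with | inst h => exact .inst (r.hasTy h)
theorem EtaSeq.hasSeq {A : Variant} : ∀ {Ψ : Stack B} {Ms Ns : TmSeq B}, EtaSeq A Ψ Ms Ns →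
    ∀ {Ts : TySeq B}, HasSeq A Ψ Ms Ts → HasSeq A Ψ Ns Ts
  | _, _, _, .last r, Ts, h => by cases h with | seq h k => exact .seq h (r.hasTy k)
  | _, _, _, .init r, Ts, h => by cases h with | seq h k => exact .seq (r.hasSeq h) k
  | _, _, _, .initW r, Ts, h => by cases h with | seqC h hi => exact .seqC (r.hasSeq h) hi
end

end CtxModal

theorem mainTheorem3 {B : Type*} (A : CtxModal.Variant) (Ψ : CtxModal.Stack B)
    (M N : CtxModal.Tm B) (T : CtxModal.Ty B) (hM : CtxModal.HasTy A Ψ M T) :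
    (CtxModal.Beta M N → CtxModal.HasTy A Ψ N T) ∧
      (CtxModal.Eta A Ψ M N → CtxModal.HasTy A Ψ N T) := by
  exact ⟨fun r => r.hasTy hM, fun r => r.hasTy hM⟩
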